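/- Let $\rho:\mathbb N\to\mathbb R$ be a correlation function with $\rho(0)=1$, and let $(a_k)_{k\ge1}$ and $(b_k)_{k\ge1}$ be two independent centered stationary Gaussian processes on a probability space $(\Omega,\mathcal F,\mathbb P)$ with $\mathbb E[a_ka_l]=\mathbb E[b_kb_l]=\rho(|k-l|)$ for all $k,l\ge1$. The spectral measure of $\rho$ is the symmetric probability measure $\mu_\rho$ on $[-\pi,\pi]$ with $\rho(k)=\int e^{ikx}\,\mu_\rho(dx)$ for all $k\ge0$. For $n\ge1$ put $$f_n(x)=\frac1{\sqrt n}\sum_{k=1}^n\bigl(a_k\cos(kx)+b_k\sin(kx)\bigr),$$ and let $\mathcal N(f_n,[0,2\pi])=\#\{t\in[0,2\pi]: f_n(t)=0\}$. Let $\alpha\in(0,\pi)$ and suppose that $\rho(0)=1$ and $\rho(k)=\frac{\sin(k\alpha)}{k\alpha}$ for $k\ge1$, i.e. $\mu_\rho(dx)=\frac1{2\alpha}\mathbf 1_{[-\alpha,\alpha]}(x)\,dx$. Then $$\lim_{n\to\infty}\frac{\mathbb E[\mathcal N(f_n,[0,2\pi])]}{n}=\frac{2\pi-2\alpha}{\pi\sqrt2}+\frac{2\alpha}{\pi\sqrt3}.$$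 Moreover, for every $\ell\in\bigl[\frac2{\sqrt3},\sqrt2\bigr)$ there is a spectral density for which $\lim_{n\to\infty}\mathbb E[\mathcal N(f_n,[0,2\pi])]/n=\ell$; it can be taken of the form $\frac1{2\alpha}\mathbf 1_{[-\alpha,\alpha]}$ with $\alpha\in(0,\pi]$ (where $\alpha=\pi$ is the case of independent coefficients, $\rho(k)=\mathbf 1_{\{k=0\}}$, and gives $\ell=\frac2{\sqrt3}$). -/

import Mathlib

open MeasureTheory ProbabilityTheory Filter Topology
open scoped ENNReal

namespace TrigZeros

/-- `μ` is the spectral measure of the correlation function `ρ`: a symmetric probability measure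
on `[-π, π]` whose Fourier coefficients are the `ρ k`. -/
structure IsSpectralMeasure (μ : Measure ℝ) (ρ : ℕ → ℝ) : Prop where
  isProbabilityMeasure : IsProbabilityMeasure μ
  support : μ (Set.Icc (-Real.pi) Real.pi)ᶜ = 0
  symmetric : μ.map (fun x => -x) = μ
  fourier : ∀ k : ℕ, ∫ x, Complex.exp (Complex.I * k * x) ∂μ = (ρ k : ℂ)

/-- The sequence `a 0, a 1, …`, where `a k` stands for the coefficient with number `k + 1`, is a
centered stationary Gaussian process with correlation function `ρ`. -/
structure IsStationaryGaussian {Ω : Type*} [MeasurableSpace Ω] (P : Measure Ω)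
    (ρ : ℕ → ℝ) (a : ℕ → Ω → ℝ) : Prop where
  measurable : ∀ k, Measurable (a k)
  gaussian : IsGaussianProcess a P
  centered : ∀ k, ∫ ω, a k ω ∂P = 0
  correlation : ∀ k l : ℕ, ∫ ω, a k ω * a l ω ∂P = ρ ((k : ℤ) - (l : ℤ)).natAbs

/-- The two coefficient sequences are independent stationary Gaussian processes, each with
correlation function `ρ`. -/
structure IsModel {Ω : Type*} [MeasurableSpace Ω] (P : Measure Ω)
    (ρ : ℕ → ℝ) (a b : ℕ → Ω → ℝ) : Prop where
  left : IsStationaryGaussian P ρ a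
  right : IsStationaryGaussian P ρ b
  indep : IndepFun (fun ω k => a k ω) (fun ω k => b k ω) P

/-- The random trigonometric polynomial
`f_n(x) = n^{-1/2} ∑_{j=1}^n (a_j cos (j x) + b_j sin (j x))`; the coefficient with number
`j = k + 1` is stored at index `k`. -/
noncomputable def trigPoly {Ω : Type*} (a b : ℕ → Ω → ℝ) (n : ℕ) (ω : Ω) (x : ℝ) : ℝ :=
  1 / Real.sqrt n * ∑ k ∈ Finset.range n,
    (a k ω * Real.cos (((k + 1 : ℕ) : ℝ) * x) + b k ω * Real.sin (((k + 1 : ℕ) : ℝ) * x))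

/-- The number of zeros of `f` in `[s, t]`, counted without multiplicity
(`∞` if there are infinitely many). -/
noncomputable def zeroCount (f : ℝ → ℝ) (s t : ℝ) : ℝ≥0∞ :=
  ((Set.encard {x | x ∈ Set.Icc s t ∧ f x = 0} : ℕ∞) : ℝ≥0∞)

/-- The number of zeros of `f_n` in `[0, 2π]` is a random variable for every `n`, and its
expectation divided by `n` tends to the real number `L`. -/
def MeanZerosTendsto {Ω : Type*} [MeasurableSpace Ω] (P : Measure Ω)
    (a b : ℕ → Ω → ℝ) (L : ℝ) : Prop :=
  (∀ n : ℕ, AEMeasurable (fun ω => zeroCount (trigPoly a b n ω) 0 (2 * Real.pi)) P) ∧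
  Tendsto (fun n : ℕ => (∫⁻ ω, zeroCount (trigPoly a b n ω) 0 (2 * Real.pi) ∂P) / (n : ℝ≥0∞))
    atTop (𝓝 (ENNReal.ofReal L))

/-- The density `(1 / 2α) 1_{[-α, α]}`. -/
noncomputable def crenelDensity (α : ℝ) (x : ℝ) : ℝ :=
  Set.indicator (Set.Icc (-α) α) (fun _ => 1 / (2 * α)) x

/-- The measure on `ℝ` with density `(1 / 2α) 1_{[-α, α]}` with respect to Lebesgue measure. -/
noncomputable def crenelMeasure (α : ℝ) : Measure ℝ :=
  volume.withDensity (fun x => ENNReal.ofReal (crenelDensity α x))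

/-- The correlation function `ρ(k) = sin (k α) / (k α)`, with `ρ(0) = 1`. -/
noncomputable def crenelCorrelation (α : ℝ) (k : ℕ) : ℝ :=
  if k = 0 then 1 else Real.sin (k * α) / (k * α)

end TrigZeros

/-!
The argument is the Kac–Rice formula followed by an asymptotic analysis of the density of zeros.

**Kac–Rice without levels.** By decorrelating from the first coefficient `a₁`, a standard Gaussian
variable `X`, the random polynomial is written as `X φ + h`, where `φ x` is its covariance with `a₁`
and `h` is a Gaussian process independent of `X`. For a fixed `h`, the zeros are the solutions of
`-h / φ = X`, so that averaging over `X` is an instance of the area formula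
(`lintegral_encard_preimage_mul`, `lintegral_zeroCount_gaussianReal`). The zeros of `φ` form a
countable set, at which almost surely `h` does not vanish. Averaging over `h` is then a Gaussian
integral (`lintegral_abs_mul_exp_neg_sq`), and `lintegral_zeroCount_gaussian` is the formula
`E N = ∫ π⁻¹ √(Var f' Var f - Cov(f, f')²) / Var f`.

**The covariances.** Since the spectral measure is uniform on `[-α, α]`, the variances of `f_n x` and
`f_n' x` are multiples of the integrals over the window `[x - α, x + α]` of the kernels
`|∑ e^{iju}|²` and `|∑ j e^{iju}|²` (`kerSq`, `kerDerivSq`), and their covariance is a multiple of the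
integral of half the derivative of the first kernel (`kerCross`). This gives `zeroDensity` and
`IsModel.lintegral_zeroCount`.

**The limit of the density.** For `|x| < α` the window contains the peak of the kernels at `0`, and
away from the peak the integrals are negligible: up to `o(1)` they are those over a full period,
which Parseval's identity evaluates. The ratio `∑ j² / (n · n²)` tends to `1 / 3`
(`tendsto_zeroDensity_inside`). For `α < x ≤ π` the window avoids the peak; there `kerSq` is
`sin² (n u / 2) / sin² (u / 2)`, whose oscillating factor averages to `1 / 2` by the Riemann–Lebesgue
lemma, while `kerDerivSq` is equivalent to `n² / (4 sin² (u / 2))`: the ratio tends to `1 / 2`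
(`tendsto_zeroDensity_outside`). The normalized densities are dominated by a multiple of
`|x - α| ^ (-1/2)`, so the limit of the mean follows by dominated convergence
(`tendsto_lintegral_zeroDensity`, `meanZerosTendsto`).

**Attaining every value.** The limit is an affine function of `α` which runs through `[2 / √3, √2)`
for `α ∈ (0, π]` (`exists_limit_eq`). The Gaussian sequences exist because the correlation is the Gram
matrix of the exponentials in `L²` of the spectral measure; the Gram–Schmidt process turns it into a
triangular matrix acting on independent standard Gaussian variables (`exists_isModel`).
-/

namespace TrigZeros

/-! ### Counting solutions of one-dimensional equations -/

/-- A set on which the strict derivative of `F` does not vanish splits into countably many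
measurable pieces on which `F` is injective. -/
lemma exists_injOn_partition {F F' : ℝ → ℝ} {s : Set ℝ} (hs : MeasurableSet s)
    (hF : ∀ x ∈ s, HasStrictDerivAt F (F' x) x) (hF0 : ∀ x ∈ s, F' x ≠ 0) :
    ∃ A : ℕ → Set ℝ, (∀ i, MeasurableSet (A i)) ∧ (∀ i, Set.InjOn F (A i)) ∧
      Pairwise (Function.onFun Disjoint A) ∧ ⋃ i, A i = s := by
  have hN : ∀ x ∈ s, ∃ N : Set ℝ, IsOpen N ∧ x ∈ N ∧ Set.InjOn F N := by
    intro x hx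
    have h := (hF x hx).hasStrictFDerivAt_equiv (hF0 x hx)
    exact ⟨(h.toOpenPartialHomeomorph F).source, (h.toOpenPartialHomeomorph F).open_source,
      h.mem_toOpenPartialHomeomorph_source, (h.toOpenPartialHomeomorph F).injOn⟩
  choose! N hNo hxN hNi using hN
  obtain ⟨t, hts, htc, hcov⟩ := TopologicalSpace.countable_cover_nhdsWithin
    (fun x hx => mem_nhdsWithin_of_mem_nhds ((hNo x hx).mem_nhds (hxN x hx)))
  obtain ⟨B, hB, hBu⟩ := (Set.exists_seq_cover_iff_countable
    (p := fun A : Set ℝ => MeasurableSet A ∧ Set.InjOn F (A ∩ s))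
    ⟨∅, MeasurableSet.empty, by simp⟩).2
    ⟨insert sᶜ (N '' t), (htc.image N).insert _, by
      rintro A (rfl | ⟨x, hx, rfl⟩)
      · exact ⟨hs.compl, by simp⟩
      · exact ⟨(hNo x (hts hx)).measurableSet, (hNi x (hts hx)).mono Set.inter_subset_left⟩, by
      rw [Set.eq_univ_iff_forall]
      intro x
      by_cases hx : x ∈ s
      · obtain ⟨y, hy, hxy⟩ := Set.mem_iUnion₂.1 (hcov hx)
        exact ⟨N y, Or.inr ⟨y, hy, rfl⟩, hxy⟩
      · exact ⟨sᶜ, Or.inl rfl, hx⟩⟩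
  refine ⟨fun i => disjointed B i ∩ s, fun i => ?_, fun i => ?_, fun i j hij => ?_, ?_⟩
  · exact (MeasurableSet.disjointed (fun i => (hB i).1) i).inter hs
  · exact (hB i).2.mono (Set.inter_subset_inter_left _ (disjointed_subset B i))
  · exact (disjoint_disjointed B hij).mono Set.inter_subset_left Set.inter_subset_left
  · rw [← Set.iUnion_inter, iUnion_disjointed, hBu, Set.univ_inter]

/-- The area formula in dimension one, with multiplicity (Banach's indicatrix): integrating the
number of solutions of `F x = y` in `s` over the levels `y` yields the integral of `|F'|`. The
critical points do not contribute because their image is a null set. -/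
theorem lintegral_encard_preimage_mul {F F' : ℝ → ℝ} {s : Set ℝ} (hs : MeasurableSet s)
    (hF : ∀ x ∈ s, HasStrictDerivAt F (F' x) x) (hF' : Measurable F') {g : ℝ → ℝ≥0∞}
    (hg : Measurable g) :
    ∫⁻ y, ((Set.encard {x | x ∈ s ∧ F x = y} : ℕ∞) : ℝ≥0∞) * g y
      = ∫⁻ x in s, ENNReal.ofReal |F' x| * g (F x) := by
  set s₀ := {x | x ∈ s ∧ F' x = 0} with hs₀
  set s₁ := {x | x ∈ s ∧ F' x ≠ 0} with hs₁
  have hm₀ : MeasurableSet s₀ := hs.inter (hF' (measurableSet_singleton 0))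
  have hm₁ : MeasurableSet s₁ := hs.inter (hF' (measurableSet_singleton 0)).compl
  obtain ⟨A, hAm, hAi, hAd, hAu⟩ := exists_injOn_partition hm₁ (fun x hx => hF x hx.1)
    (fun x hx => hx.2)
  have hAs : ∀ i, A i ⊆ s := fun i x hx =>
    (show x ∈ s₁ from hAu ▸ Set.mem_iUnion_of_mem i hx).1
  have hcont : ∀ i, ContinuousOn F (A i) := fun i x hx =>
    (hF x (hAs i hx)).hasDerivAt.continuousAt.continuousWithinAt
  have hAim : ∀ i, MeasurableSet (F '' A i) := fun i =>
    (hAm i).image_of_continuousOn_injOn (hcont i) (hAi i)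
  have hcrit : volume (F '' s₀) = 0 :=
    addHaar_image_eq_zero_of_det_fderivWithin_eq_zero volume
      (fun x hx => ((hF x hx.1).hasDerivAt.hasDerivWithinAt).hasFDerivWithinAt)
      (fun x hx => by simp [hx.2])
  have hsub : ∀ i y, (A i ∩ F ⁻¹' {y}).Subsingleton := fun i y a ha b hb =>
    hAi i ha.1 hb.1 (ha.2.trans hb.2.symm)
  have hcount : ∀ᵐ y, ((Set.encard {x | x ∈ s ∧ F x = y} : ℕ∞) : ℝ≥0∞) * g y
      = ∑' i, (F '' A i).indicator g y := by
    have : ∀ᵐ y, y ∉ F '' s₀ := by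
      exact measure_eq_zero_iff_ae_notMem.1 hcrit
    filter_upwards [this] with y hy
    have hset : {x | x ∈ s ∧ F x = y} = ⋃ i, (A i ∩ F ⁻¹' {y}) := by
      rw [← Set.iUnion_inter, hAu]
      ext x
      constructor
      · rintro ⟨hx, hxy⟩
        exact ⟨⟨hx, fun h0 => hy ⟨x, ⟨hx, h0⟩, hxy⟩⟩, hxy⟩
      · rintro ⟨hx, hxy⟩
        exact ⟨hx.1, hxy⟩
    have hmeas : ∀ i, MeasurableSet (A i ∩ F ⁻¹' {y}) := fun i => (hsub i y).measurableSet
    rw [hset, ← Measure.count_apply (MeasurableSet.iUnion hmeas), measure_iUnion _ hmeas,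
      ← ENNReal.tsum_mul_right]
    · congr 1
      ext i
      by_cases h : y ∈ F '' A i
      · obtain ⟨x, hx, rfl⟩ := h
        have : A i ∩ F ⁻¹' {F x} = {x} :=
          (hsub i (F x)).eq_singleton_of_mem ⟨hx, rfl⟩
        rw [this, Measure.count_singleton, one_mul,
          Set.indicator_of_mem (Set.mem_image_of_mem F hx)]
      · have : A i ∩ F ⁻¹' {y} = ∅ := by
          ext x
          simp only [Set.mem_inter_iff, Set.mem_preimage, Set.mem_singleton_iff,
            Set.mem_empty_iff_false, iff_false, not_and]
          exact fun hx hxy => h ⟨x, hx, hxy⟩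
        rw [this, measure_empty, zero_mul, Set.indicator_of_notMem h]
    · exact fun i j hij => (hAd hij).mono Set.inter_subset_left Set.inter_subset_left
  rw [lintegral_congr_ae hcount, lintegral_tsum (fun i => (hg.indicator (hAim i)).aemeasurable)]
  have hpiece : ∀ i, ∫⁻ y, (F '' A i).indicator g y
      = ∫⁻ x in A i, ENNReal.ofReal |F' x| * g (F x) := fun i => by
    rw [lintegral_indicator (hAim i)]
    exact lintegral_image_eq_lintegral_abs_deriv_mul (hAm i)
      (fun x hx => (hF x (hAs i hx)).hasDerivAt.hasDerivWithinAt) (hAi i) g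
  rw [tsum_congr hpiece, ← lintegral_iUnion hAm hAd, hAu]
  have hsplit : s = s₁ ∪ s₀ := by
    ext x
    simp only [hs₀, hs₁, Set.mem_union, Set.mem_ofPred_eq]
    tauto
  rw [hsplit, lintegral_union hm₀ (Set.disjoint_left.2 fun x hx hx' => hx.2 hx'.2)]
  rw [setLIntegral_congr_fun (g := fun _ => 0) hm₀ (fun x hx => by simp [hx.2])]
  simp

lemma measurableSet_exists_zero_Icc {Θ : Type*} [MeasurableSpace Θ] {f : Θ → ℝ → ℝ}
    (hc : ∀ θ, Continuous (f θ)) (hm : ∀ x, Measurable fun θ => f θ x) (p q : ℝ) :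
    MeasurableSet {θ | ∃ x ∈ Set.Icc p q, f θ x = 0} := by
  obtain ⟨D, hDc, hDd⟩ := TopologicalSpace.exists_countable_dense (Set.Icc p q)
  have hset : {θ | ∃ x ∈ Set.Icc p q, f θ x = 0}
      = ⋂ m : ℕ, ⋃ r ∈ D, {θ | |f θ r| < 1 / ((m : ℝ) + 1)} := by
    ext θ
    simp only [Set.mem_ofPred_eq, Set.mem_iInter, Set.mem_iUnion, exists_prop]
    have hc' : Continuous fun r : Set.Icc p q => |f θ r| :=
      ((hc θ).comp continuous_subtype_val).abs
    constructor
    · rintro ⟨x, hx, h0⟩ m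
      have hopen : IsOpen {r : Set.Icc p q | |f θ r| < 1 / ((m : ℝ) + 1)} :=
        isOpen_lt hc' continuous_const
      obtain ⟨r, hr, hrD⟩ := hDd.inter_open_nonempty _ hopen
        ⟨⟨x, hx⟩, by simp only [Set.mem_ofPred_eq, h0, abs_zero]; positivity⟩
      exact ⟨r, hrD, hr⟩
    · intro h
      obtain ⟨r₀, -, -⟩ := h 0
      have : Nonempty (Set.Icc p q) := ⟨r₀⟩
      obtain ⟨x, -, hx⟩ := (isCompact_univ (X := Set.Icc p q)).exists_isMinOn Set.univ_nonempty
        hc'.continuousOn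
      refine ⟨x, x.2, ?_⟩
      by_contra hne
      obtain ⟨m, hm⟩ := exists_nat_one_div_lt (abs_pos.2 hne)
      obtain ⟨r, -, hr⟩ := h m
      exact absurd (hx (Set.mem_univ r)) (not_le.2 (hr.trans hm))
  rw [hset]
  refine MeasurableSet.iInter fun m => MeasurableSet.biUnion hDc fun r _ => ?_
  exact measurableSet_lt (measurable_norm.comp (hm r)) measurable_const

lemma encard_eq_iSup_image_floor (A : Set ℝ) :
    ((A.encard : ℕ∞) : ℝ≥0∞)
      = ⨆ m : ℕ, ((((fun x : ℝ => ⌊((m : ℝ) + 1) * x⌋) '' A).encard : ℕ∞) : ℝ≥0∞) := by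
  refine le_antisymm ?_ (iSup_le fun m => by exact_mod_cast Set.encard_image_le _ _)
  have key : ∀ G : Finset ℝ, (G : Set ℝ) ⊆ A → (G.card : ℝ≥0∞)
      ≤ ⨆ m : ℕ, ((((fun x : ℝ => ⌊((m : ℝ) + 1) * x⌋) '' A).encard : ℕ∞) : ℝ≥0∞) := by
    intro G hG
    have hδ : ∃ m : ℕ, ∀ x ∈ G, ∀ y ∈ G, x ≠ y → 1 / ((m : ℝ) + 1) < |x - y| := by
      have : ∀ᶠ m : ℕ in atTop, ∀ x ∈ G, ∀ y ∈ G, x ≠ y → 1 / ((m : ℝ) + 1) < |x - y| := by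
        rw [Filter.eventually_all_finset]
        intro x _
        rw [Filter.eventually_all_finset]
        intro y _
        by_cases hxy : x = y
        · simp [hxy]
        · filter_upwards [tendsto_one_div_add_atTop_nhds_zero_nat.eventually_lt_const
            (abs_pos.2 (sub_ne_zero.2 hxy))] with m hm _ using hm
      exact this.exists
    obtain ⟨m, hm⟩ := hδ
    refine le_trans ?_ (le_iSup _ m)
    have hinj : Set.InjOn (fun x : ℝ => ⌊((m : ℝ) + 1) * x⌋) (G : Set ℝ) := by
      intro x hx y hy hxy
      by_contra hne
      have h1 := Int.abs_sub_lt_one_of_floor_eq_floor hxy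
      have h2 := hm x hx y hy hne
      have hpos : (0 : ℝ) < (m : ℝ) + 1 := by positivity
      rw [← mul_sub, abs_mul, abs_of_pos hpos] at h1
      rw [div_lt_iff₀ hpos] at h2
      linarith
    have : (G.card : ℕ∞) ≤ ((fun x : ℝ => ⌊((m : ℝ) + 1) * x⌋) '' A).encard := by
      rw [← Set.encard_coe_eq_coe_finsetCard, ← hinj.encard_image]
      exact Set.encard_le_encard (Set.image_mono hG)
    have h3 : ((G.card : ℕ∞) : ℝ≥0∞)
        ≤ ((((fun x : ℝ => ⌊((m : ℝ) + 1) * x⌋) '' A).encard : ℕ∞) : ℝ≥0∞) := by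
      exact_mod_cast this
    simpa using h3
  by_cases hA : A.Finite
  · have := key hA.toFinset (by simp)
    rw [hA.encard_eq_coe_toFinset_card]
    simpa using this
  · rw [Set.Infinite.encard_eq hA, ENat.toENNReal_top, top_le_iff]
    refine ENNReal.eq_top_of_forall_nnreal_le fun r => ?_
    obtain ⟨k, hk⟩ := exists_nat_ge r
    obtain ⟨G, hG, hGc⟩ := (Set.not_finite.1 hA).exists_subset_card_eq k
    refine le_trans ?_ (key G hG)
    rw [hGc]
    exact_mod_cast hk

/-- The number of zeros in `[s, t]` of a continuous function depending measurably on a parameter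
is a measurable function of the parameter: it is the supremum over `m` of the number of cells of
the grid of mesh `1 / (m + 1)` that contain a zero. -/
theorem measurable_zeroCount {Θ : Type*} [MeasurableSpace Θ] {f : Θ → ℝ → ℝ}
    (hc : ∀ θ, Continuous (f θ)) (hm : ∀ x, Measurable fun θ => f θ x) (s t : ℝ) :
    Measurable fun θ => zeroCount (f θ) s t := by
  unfold zeroCount
  simp_rw [encard_eq_iSup_image_floor]
  refine Measurable.iSup fun m => ?_
  have htsum : ∀ B : Set ℤ, ((B.encard : ℕ∞) : ℝ≥0∞) = ∑' j : ℤ, B.indicator 1 j := fun B => by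
    rw [← ENNReal.tsum_set_one, ← tsum_subtype B 1]
    rfl
  simp_rw [htsum]
  refine Measurable.tsum fun j => ?_
  have hpos : (0 : ℝ) < (m : ℝ) + 1 := by positivity
  have hset : MeasurableSet {θ | j ∈ (fun x : ℝ => ⌊((m : ℝ) + 1) * x⌋) ''
      {x | x ∈ Set.Icc s t ∧ f θ x = 0}} := by
    have : {θ | j ∈ (fun x : ℝ => ⌊((m : ℝ) + 1) * x⌋) '' {x | x ∈ Set.Icc s t ∧ f θ x = 0}}
        = ⋃ k : ℕ, {θ | ∃ x ∈ Set.Icc (max s (j / ((m : ℝ) + 1)))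
            (min t ((j + 1) / ((m : ℝ) + 1) - 1 / ((k : ℝ) + 1))), f θ x = 0} := by
      ext θ
      simp only [Set.mem_image, Set.mem_ofPred_eq, Set.mem_iUnion, Set.mem_Icc, max_le_iff,
        le_min_iff, Int.floor_eq_iff]
      constructor
      · rintro ⟨x, ⟨⟨hsx, hxt⟩, h0⟩, hj1, hj2⟩
        have hlt : x < (j + 1) / ((m : ℝ) + 1) := by
          rw [lt_div_iff₀ hpos]; linarith
        obtain ⟨k, hk⟩ := exists_nat_one_div_lt (sub_pos.2 hlt)
        refine ⟨k, x, ⟨⟨hsx, ?_⟩, hxt, by linarith⟩, h0⟩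
        rw [div_le_iff₀ hpos]; linarith
      · rintro ⟨k, x, ⟨⟨hsx, hj1⟩, hxt, hj2⟩, h0⟩
        have hk : (0 : ℝ) < 1 / ((k : ℝ) + 1) := by positivity
        have hlt : x < (j + 1) / ((m : ℝ) + 1) := by linarith
        rw [lt_div_iff₀ hpos] at hlt
        rw [div_le_iff₀ hpos] at hj1
        exact ⟨x, ⟨⟨hsx, hxt⟩, h0⟩, by linarith, by linarith⟩
    rw [this]
    exact MeasurableSet.iUnion fun k => measurableSet_exists_zero_Icc hc hm _ _
  exact measurable_const.indicator hset

/-! ### Gaussian integrals -/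

lemma lintegral_abs_gaussianReal_std :
    ∫⁻ x, ENNReal.ofReal |x| ∂(gaussianReal 0 1) = ENNReal.ofReal (Real.sqrt (2 / Real.pi)) := by
  have hint : ∫ x in Set.Ioi (0 : ℝ), x * Real.exp (-(1 / 2) * x ^ 2) = 1 := by
    have h := integral_mul_cexp_neg_mul_sq (b := 1 / 2) (by norm_num)
    have h2 : ((∫ x in Set.Ioi (0 : ℝ), x * Real.exp (-(1 / 2) * x ^ 2) : ℝ) : ℂ) = 1 := by
      rw [← integral_complex_ofReal]
      push_cast
      rw [h]
      norm_num
    exact_mod_cast h2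
  have hI : Integrable (fun x : ℝ => x * Real.exp (-(1 / 2) * x ^ 2)) := by
    exact integrable_mul_exp_neg_mul_sq (by norm_num)
  have habs : ∫ x : ℝ, |x| * Real.exp (-(1 / 2) * x ^ 2) = 2 := by
    have := integral_comp_abs (f := fun x : ℝ => x * Real.exp (-(1 / 2) * x ^ 2))
    simp only [sq_abs] at this
    rw [this, hint, mul_one]
  have hIabs : Integrable (fun x : ℝ => |x| * Real.exp (-(1 / 2) * x ^ 2)) := by
    refine hI.norm.congr (ae_of_all _ fun x => ?_)
    simp
  rw [gaussianReal_of_var_ne_zero _ one_ne_zero,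
    lintegral_withDensity_eq_lintegral_mul _ (measurable_gaussianPDF 0 1) (by fun_prop)]
  have hpt : ∀ x : ℝ, (gaussianPDF 0 1 * fun x => ENNReal.ofReal |x|) x
      = ENNReal.ofReal ((Real.sqrt (2 * Real.pi))⁻¹ *
        (|x| * Real.exp (-(1 / 2) * x ^ 2))) := by
    intro x
    rw [Pi.mul_apply, gaussianPDF, ← ENNReal.ofReal_mul (gaussianPDFReal_nonneg _ _ _)]
    congr 1
    simp only [gaussianPDFReal, NNReal.coe_one, mul_one, sub_zero]
    rw [show -x ^ 2 / 2 = -(1 / 2) * x ^ 2 by ring]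
    ring
  simp_rw [hpt]
  rw [← ofReal_integral_eq_lintegral_ofReal (hIabs.const_mul _)
    (ae_of_all _ fun x => by positivity), integral_const_mul, habs]
  congr 1
  rw [Real.sqrt_div (by norm_num), Real.sqrt_mul (by norm_num)]
  have h2 : Real.sqrt 2 * Real.sqrt 2 = 2 := Real.mul_self_sqrt (by norm_num)
  have : Real.sqrt Real.pi ≠ 0 := by positivity
  field_simp
  linarith

lemma lintegral_abs_gaussianReal (v : NNReal) :
    ∫⁻ x, ENNReal.ofReal |x| ∂(gaussianReal 0 v)
      = ENNReal.ofReal (Real.sqrt (2 / Real.pi) * Real.sqrt v) := by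
  have h : gaussianReal 0 v = (gaussianReal 0 1).map (Real.sqrt v * ·) := by
    rw [gaussianReal_map_const_mul]
    congr 1
    · simp
    · ext; simp
  rw [h, lintegral_map (by fun_prop) (by fun_prop)]
  simp_rw [abs_mul, abs_of_nonneg (Real.sqrt_nonneg _), ENNReal.ofReal_mul (Real.sqrt_nonneg _)]
  rw [lintegral_const_mul _ (by fun_prop), lintegral_abs_gaussianReal_std, mul_comm]

/-- Weighting a centered Gaussian law of variance `s` with `exp (-u ^ 2 / 2)` gives, up to the
factor `1 / √(1 + s)`, the centered Gaussian law of variance `s / (1 + s)`. -/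
lemma lintegral_exp_neg_sq_mul_gaussianReal (s : NNReal) {g : ℝ → ℝ≥0∞} (hg : Measurable g) :
    ∫⁻ u, ENNReal.ofReal (Real.exp (-u ^ 2 / 2)) * g u ∂(gaussianReal 0 s)
      = ENNReal.ofReal (1 / Real.sqrt (1 + s)) * ∫⁻ u, g u ∂(gaussianReal 0 (s / (1 + s))) := by
  rcases eq_or_ne s 0 with rfl | hs
  · simp [gaussianReal_zero_var, lintegral_dirac' _ hg]
  · have hs' : s / (1 + s) ≠ 0 := by positivity
    rw [gaussianReal_of_var_ne_zero _ hs, gaussianReal_of_var_ne_zero _ hs',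
      lintegral_withDensity_eq_lintegral_mul _ (measurable_gaussianPDF 0 _) (by fun_prop),
      lintegral_withDensity_eq_lintegral_mul _ (measurable_gaussianPDF 0 _) hg,
      ← lintegral_const_mul _ ((measurable_gaussianPDF 0 _).mul hg)]
    refine lintegral_congr fun u => ?_
    have hs0 : (0 : ℝ) < s := by positivity
    have key : gaussianPDFReal 0 s u * Real.exp (-u ^ 2 / 2)
        = 1 / Real.sqrt (1 + s) * gaussianPDFReal 0 (s / (1 + s)) u := by
      simp only [gaussianPDFReal, sub_zero, NNReal.coe_div, NNReal.coe_add, NNReal.coe_one]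
      rw [mul_assoc, ← Real.exp_add, ← mul_assoc]
      congr 1
      · rw [one_div, ← mul_inv, ← Real.sqrt_mul (by positivity)]
        congr 2
        field_simp
      · congr 1
        field_simp
        ring
    simp only [Pi.mul_apply, gaussianPDF]
    rw [← mul_assoc, ← mul_assoc, ← ENNReal.ofReal_mul (gaussianPDFReal_nonneg _ _ _),
      ← ENNReal.ofReal_mul (by positivity), key]

lemma covariance_eq_zero_of_variance_eq_zero {Ω : Type*} [MeasurableSpace Ω] {P : Measure Ω}
    [IsProbabilityMeasure P] {U W : Ω → ℝ} (hU : MemLp U 2 P) (h : Var[U; P] = 0) :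
    cov[U, W; P] = 0 := by
  have h0 := ae_eq_integral_of_variance_eq_zero hU h
  rw [covariance]
  refine integral_eq_zero_of_ae ?_
  filter_upwards [h0] with ω hω
  simp [hω]

/-- The Gaussian integral behind the Kac–Rice density. -/
theorem lintegral_abs_mul_exp_neg_sq {Ω : Type*} [MeasurableSpace Ω] {P : Measure Ω}
    {U W : Ω → ℝ} (h : HasGaussianLaw (fun ω => (U ω, W ω)) P) (hU0 : P[U] = 0) (hW0 : P[W] = 0) :
    ∫⁻ ω, ENNReal.ofReal (|W ω| * Real.exp (-(U ω) ^ 2 / 2)) ∂P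
      = ENNReal.ofReal (Real.sqrt (2 / Real.pi) *
        (Real.sqrt (cov[W, W; P] * (1 + cov[U, U; P]) - cov[U, W; P] ^ 2)
          / (1 + cov[U, U; P]))) := by
  have := h.isProbabilityMeasure
  have hU2 : MemLp U 2 P := h.fst.memLp_two
  have hW2 : MemLp W 2 P := h.snd.memLp_two
  have hUm : AEMeasurable U P := h.fst.aemeasurable
  have hWm : AEMeasurable W P := h.snd.aemeasurable
  set C := cov[U, W; P] with hC
  set V := cov[U, U; P] with hV
  have hVU : Var[U; P] = V := by rw [hV, covariance_self hUm]
  have hV0 : 0 ≤ V := hVU ▸ variance_nonneg _ _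
  -- `W = lam * U + R` with `R` uncorrelated with `U`, hence independent of `U`
  obtain ⟨lam, hlam⟩ : ∃ lam : ℝ, lam * V = C := by
    rcases eq_or_ne V 0 with hz | hz
    · exact ⟨0, by rw [hC, covariance_eq_zero_of_variance_eq_zero hU2 (hVU.trans hz), zero_mul]⟩
    · exact ⟨C / V, div_mul_cancel₀ _ hz⟩
  set R : Ω → ℝ := fun ω => W ω - lam * U ω with hR
  have hlU2 : MemLp (fun ω => lam * U ω) 2 P := hU2.const_mul lam
  have hR2 : MemLp R 2 P := hW2.sub hlU2
  have hUR : HasGaussianLaw (fun ω => (U ω, R ω)) P :=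
    h.map_fun ((ContinuousLinearMap.fst ℝ ℝ ℝ).prod
      (ContinuousLinearMap.snd ℝ ℝ ℝ - lam • ContinuousLinearMap.fst ℝ ℝ ℝ))
  have hcUR : cov[U, R; P] = 0 := by
    rw [hR, covariance_fun_sub_right hU2 hW2 hlU2, covariance_const_mul_right, ← hC, ← hV, hlam,
      sub_self]
  have hind : IndepFun U R P := hUR.indepFun_of_covariance_eq_zero hcUR
  have hR0 : P[R] = 0 := by
    rw [hR, integral_sub (hW2.integrable (by norm_num)) (hlU2.integrable (by norm_num)),
      integral_const_mul, hU0, hW0]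
    simp
  have hcRR : Var[R; P] = cov[W, W; P] - lam * C := by
    rw [← covariance_self hUR.snd.aemeasurable]
    nth_rewrite 1 [hR]
    rw [covariance_fun_sub_left hW2 hlU2 hR2, covariance_const_mul_left, hcUR, hR,
      covariance_fun_sub_right hW2 hW2 hlU2, covariance_const_mul_right, covariance_comm W U, ← hC]
    ring
  have hlawU : P.map U = gaussianReal 0 V.toNNReal := by
    rw [h.fst.map_eq_gaussianReal, hU0, hVU]
  have hlawR : P.map R = gaussianReal 0 (Var[R; P]).toNNReal := by
    rw [hUR.snd.map_eq_gaussianReal, hR0]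
  have hjoint : P.map (fun ω => (U ω, R ω))
      = (gaussianReal 0 V.toNNReal).prod (gaussianReal 0 (Var[R; P]).toNNReal) := by
    rw [(indepFun_iff_map_prod_eq_prod_map_map hUm hUR.snd.aemeasurable).1 hind, hlawU, hlawR]
  have hV' : ((V.toNNReal : NNReal) : ℝ) = V := Real.coe_toNNReal _ hV0
  set s := V.toNNReal with hs
  set τ := (Var[R; P]).toNNReal with hτ
  have hτ' : (τ : ℝ) = cov[W, W; P] - lam * C := by
    rw [hτ, Real.coe_toNNReal _ (variance_nonneg _ _), hcRR]
  have e1 : ∫⁻ ω, ENNReal.ofReal (|W ω| * Real.exp (-(U ω) ^ 2 / 2)) ∂P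
      = ∫⁻ p : ℝ × ℝ, ENNReal.ofReal (Real.exp (-p.1 ^ 2 / 2)) * ENNReal.ofReal |lam * p.1 + p.2|
        ∂((gaussianReal 0 s).prod (gaussianReal 0 τ)) := by
    rw [← hjoint, lintegral_map' (by fun_prop) hUR.aemeasurable]
    refine lintegral_congr fun ω => ?_
    rw [← ENNReal.ofReal_mul (by positivity), mul_comm]
    simp [hR]
  have e2 : ∫⁻ p : ℝ × ℝ, ENNReal.ofReal (Real.exp (-p.1 ^ 2 / 2)) * ENNReal.ofReal
        |lam * p.1 + p.2| ∂((gaussianReal 0 s).prod (gaussianReal 0 τ))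
      = ENNReal.ofReal (1 / Real.sqrt (1 + s)) *
        ∫⁻ u, ∫⁻ r, ENNReal.ofReal |lam * u + r| ∂(gaussianReal 0 τ)
          ∂(gaussianReal 0 (s / (1 + s))) := by
    rw [lintegral_prod _ (by fun_prop)]
    have hmeas : Measurable fun u : ℝ =>
        ∫⁻ r, ENNReal.ofReal |lam * u + r| ∂(gaussianReal 0 τ) := by
      refine Measurable.lintegral_prod_right' (f := fun p : ℝ × ℝ =>
        ENNReal.ofReal |lam * p.1 + p.2|) (by fun_prop)
    rw [← lintegral_exp_neg_sq_mul_gaussianReal s hmeas]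
    refine lintegral_congr fun u => ?_
    have hr : Measurable fun r : ℝ => ENNReal.ofReal |lam * u + r| := by fun_prop
    exact lintegral_const_mul (ENNReal.ofReal (Real.exp (-u ^ 2 / 2))) hr
  have e3 : ∫⁻ u, ∫⁻ r, ENNReal.ofReal |lam * u + r| ∂(gaussianReal 0 τ)
          ∂(gaussianReal 0 (s / (1 + s)))
      = ENNReal.ofReal (Real.sqrt (2 / Real.pi) *
          Real.sqrt (lam ^ 2 * (s / (1 + s)) + τ)) := by
    have hmeas : Measurable fun u : ℝ =>
        ∫⁻ r, ENNReal.ofReal |u + r| ∂(gaussianReal 0 τ) := by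
      refine Measurable.lintegral_prod_right' (f := fun p : ℝ × ℝ =>
        ENNReal.ofReal |p.1 + p.2|) (by fun_prop)
    rw [← lintegral_map hmeas (measurable_const_mul lam), gaussianReal_map_const_mul, mul_zero,
      ← Measure.lintegral_conv (f := fun x => ENNReal.ofReal |x|) (by fun_prop),
      gaussianReal_conv_gaussianReal, add_zero, lintegral_abs_gaussianReal]
    congr 3
  rw [e1, e2, e3, ← ENNReal.ofReal_mul (by positivity)]
  congr 1
  rw [hV', hτ']
  have h1V : 0 < 1 + V := by positivity
  have hsq : Real.sqrt (1 + V) * Real.sqrt (1 + V) = 1 + V := Real.mul_self_sqrt h1V.le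
  have e4 : lam ^ 2 * (V / (1 + V)) + (cov[W, W; P] - lam * C)
      = (cov[W, W; P] * (1 + V) - C ^ 2) / (1 + V) := by
    rw [← hlam]
    field_simp
    ring
  rw [e4, Real.sqrt_div' _ h1V.le]
  have : Real.sqrt (1 + V) ≠ 0 := by positivity
  set q := Real.sqrt (cov[W, W; P] * (1 + V) - C ^ 2)
  rw [show q / (1 + V) = q / (Real.sqrt (1 + V) * Real.sqrt (1 + V)) by rw [hsq]]
  field_simp

/-! ### The Kac–Rice formula -/

section KacRice

variable {Ω : Type*} [MeasurableSpace Ω] {P : Measure Ω} {ι : Type*} [Fintype ι]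
  {ξ : ι → Ω → ℝ} {e e' : ι → ℝ → ℝ}

/-- The mean number of levels: for deterministic `φ` and `h`, averaging the number of zeros of
`X φ + h` over a standard Gaussian `X` is an instance of the area formula for `-h / φ`, as long as
`h` does not vanish at the zeros of `φ`. -/
lemma lintegral_zeroCount_gaussianReal {φ φ' h h' : ℝ → ℝ}
    (hφ : ∀ x, HasDerivAt φ (φ' x) x) (hφ' : Continuous φ')
    (hh : ∀ x, HasDerivAt h (h' x) x) (hh' : Continuous h')
    (hne : ∀ x, φ x = 0 → h x ≠ 0) (s t : ℝ) :
    ∫⁻ X, zeroCount (fun x => X * φ x + h x) s t ∂(gaussianReal 0 1)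
      = ∫⁻ x in Set.Icc s t ∩ {x | φ x ≠ 0},
          ENNReal.ofReal |-(h' x * φ x - h x * φ' x) / φ x ^ 2| *
            gaussianPDF 0 1 (-h x / φ x) := by
  have hφc : Continuous φ := continuous_iff_continuousAt.2 fun x => (hφ x).continuousAt
  have hhc : Continuous h := continuous_iff_continuousAt.2 fun x => (hh x).continuousAt
  have hU : MeasurableSet (Set.Icc s t ∩ {x | φ x ≠ 0}) :=
    measurableSet_Icc.inter (hφc.measurable (measurableSet_singleton 0)).compl
  have hstrict : ∀ {u u' : ℝ → ℝ}, (∀ x, HasDerivAt u (u' x) x) → Continuous u' →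
      ∀ x, HasStrictDerivAt u (u' x) x := fun hu hu' x =>
    hasStrictDerivAt_of_hasDerivAt_of_continuousAt (Eventually.of_forall hu) hu'.continuousAt
  have hF : ∀ x ∈ Set.Icc s t ∩ {x | φ x ≠ 0}, HasStrictDerivAt (fun x => -h x / φ x)
      (-(h' x * φ x - h x * φ' x) / φ x ^ 2) x := by
    rintro x ⟨-, hx⟩
    refine (((hstrict hh hh' x).fun_neg).fun_div (hstrict hφ hφ' x) hx).congr_deriv ?_
    ring
  rw [← lintegral_encard_preimage_mul hU hF (by fun_prop) (measurable_gaussianPDF 0 1),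
    gaussianReal_of_var_ne_zero _ one_ne_zero,
    lintegral_withDensity_eq_lintegral_mul_non_measurable _ (measurable_gaussianPDF 0 1)
      (ae_of_all _ fun _ => gaussianPDF_lt_top)]
  refine lintegral_congr fun X => ?_
  rw [Pi.mul_apply, mul_comm]
  unfold zeroCount
  congr 3
  ext x
  simp only [Set.mem_ofPred_eq, Set.mem_inter_iff]
  constructor
  · rintro ⟨hx, h0⟩
    have hφx : φ x ≠ 0 := fun hz => hne x hz (by simpa [hz] using h0)
    refine ⟨⟨hx, hφx⟩, ?_⟩
    rw [div_eq_iff hφx]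
    linarith
  · rintro ⟨⟨hx, hφx⟩, h0⟩
    rw [div_eq_iff hφx] at h0
    exact ⟨hx, by linarith⟩

/-- The linear functional `y ↦ ∑ i, y i * u i`. -/
noncomputable def dotCLM (u : ι → ℝ) : (ι → ℝ) →L[ℝ] ℝ :=
  ∑ i, u i • ContinuousLinearMap.proj i

lemma dotCLM_apply (u y : ι → ℝ) : dotCLM u y = ∑ i, y i * u i := by
  simp [dotCLM, mul_comm]

lemma lintegral_density (hξ : HasGaussianLaw (fun ω i => ξ i ω) P) (h0 : ∀ i, P[ξ i] = 0)
    {i₀ : ι} (hi₀ : cov[ξ i₀, ξ i₀; P] = 1) (u u' : ι → ℝ)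
    (hv : 0 < cov[fun ω => ∑ i, ξ i ω * u i, fun ω => ∑ i, ξ i ω * u i; P])
    {p p' : ℝ} (hp : cov[fun ω => ∑ i, ξ i ω * u i, ξ i₀; P] = p)
    (hp' : cov[fun ω => ∑ i, ξ i ω * u' i, ξ i₀; P] = p') (hp0 : p ≠ 0) :
    ∫⁻ ω, ENNReal.ofReal |-((∑ i, ξ i ω * u' i - p' * ξ i₀ ω) * p
          - (∑ i, ξ i ω * u i - p * ξ i₀ ω) * p') / p ^ 2|
        * gaussianPDF 0 1 (-(∑ i, ξ i ω * u i - p * ξ i₀ ω) / p) ∂P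
      = ENNReal.ofReal (1 / Real.pi *
        (Real.sqrt (cov[fun ω => ∑ i, ξ i ω * u' i, fun ω => ∑ i, ξ i ω * u' i; P]
            * cov[fun ω => ∑ i, ξ i ω * u i, fun ω => ∑ i, ξ i ω * u i; P]
            - cov[fun ω => ∑ i, ξ i ω * u i, fun ω => ∑ i, ξ i ω * u' i; P] ^ 2)
          / cov[fun ω => ∑ i, ξ i ω * u i, fun ω => ∑ i, ξ i ω * u i; P])) := by
  have := hξ.isProbabilityMeasure
  set f : Ω → ℝ := fun ω => ∑ i, ξ i ω * u i with hf
  set f' : Ω → ℝ := fun ω => ∑ i, ξ i ω * u' i with hf'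
  set k := p' / p with hk
  -- The level of the zero is `U`, and `W` is the derivative of the process at a zero.
  set U : Ω → ℝ := fun ω => p⁻¹ * f ω - ξ i₀ ω with hU
  set W : Ω → ℝ := fun ω => f' ω - k * f ω with hW
  have hUW : HasGaussianLaw (fun ω => (U ω, W ω)) P := by
    have := hξ.map_fun ((p⁻¹ • dotCLM u - ContinuousLinearMap.proj i₀).prod
      (dotCLM u' - k • dotCLM u))
    simpa [dotCLM_apply, hU, hW, hf, hf'] using this
  have hX2 : MemLp (ξ i₀) 2 P := (hξ.eval i₀).memLp_two
  have hsum : ∀ w : ι → ℝ, MemLp (fun ω => ∑ i, ξ i ω * w i) 2 P := fun w =>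
    memLp_finsetSum _ fun i _ => (hξ.eval i).memLp_two.mul_const _
  have hf2 : MemLp f 2 P := hsum u
  have hf'2 : MemLp f' 2 P := hsum u'
  have hmean : ∀ w : ι → ℝ, ∫ ω, ∑ i, ξ i ω * w i ∂P = 0 := fun w => by
    rw [integral_finsetSum _ fun i _ => ((hξ.eval i).integrable).mul_const _]
    simp [integral_mul_const, h0]
  have hpf2 : MemLp (fun ω => p⁻¹ * f ω) 2 P := hf2.const_mul _
  have hkf2 : MemLp (fun ω => k * f ω) 2 P := hf2.const_mul _
  have hU0 : P[U] = 0 := by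
    rw [hU, integral_sub (hpf2.integrable (by norm_num)) (hX2.integrable (by norm_num)),
      integral_const_mul, hmean u, h0]
    simp
  have hW0 : P[W] = 0 := by
    rw [hW, integral_sub (hf'2.integrable (by norm_num)) (hkf2.integrable (by norm_num)),
      integral_const_mul, hmean u, hmean u']
    simp
  set v := cov[f, f; P] with hvdef
  set w := cov[f', f'; P] with hwdef
  set c := cov[f, f'; P] with hcdef
  have hU2 : MemLp U 2 P := hpf2.sub hX2
  have hW2 : MemLp W 2 P := hf'2.sub hkf2
  have cXf : cov[ξ i₀, f; P] = p := by rw [covariance_comm, hp]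
  have cXf' : cov[ξ i₀, f'; P] = p' := by rw [covariance_comm, hp']
  have cf'f : cov[f', f; P] = c := by rw [covariance_comm]
  have cUU : cov[U, U; P] = v / p ^ 2 - 1 := by
    rw [hU, covariance_fun_sub_fun_sub hpf2 hX2 hpf2 hX2]
    simp only [covariance_const_mul_left, covariance_const_mul_right, hp, cXf, hi₀, ← hvdef]
    field_simp
    ring
  have cWW : cov[W, W; P] = w - 2 * k * c + k ^ 2 * v := by
    rw [hW, covariance_fun_sub_fun_sub hf'2 hkf2 hf'2 hkf2]
    simp only [covariance_const_mul_left, covariance_const_mul_right, cf'f, ← hvdef, ← hwdef,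
      ← hcdef]
    ring
  have cUW : cov[U, W; P] = (c - k * v) / p := by
    rw [hU, hW, covariance_fun_sub_fun_sub hpf2 hX2 hf'2 hkf2]
    simp only [covariance_const_mul_left, covariance_const_mul_right, cXf, cXf', ← hvdef, ← hcdef]
    rw [hk]
    field_simp
    ring
  have hpt : ∀ ω, ENNReal.ofReal |-((f' ω - p' * ξ i₀ ω) * p - (f ω - p * ξ i₀ ω) * p') / p ^ 2|
        * gaussianPDF 0 1 (-(f ω - p * ξ i₀ ω) / p)
      = ENNReal.ofReal ((Real.sqrt (2 * Real.pi))⁻¹ * |p|⁻¹) *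
        ENNReal.ofReal (|W ω| * Real.exp (-(U ω) ^ 2 / 2)) := by
    intro ω
    rw [gaussianPDF, ← ENNReal.ofReal_mul (abs_nonneg _), ← ENNReal.ofReal_mul (by positivity)]
    congr 1
    have e1 : -((f' ω - p' * ξ i₀ ω) * p - (f ω - p * ξ i₀ ω) * p') / p ^ 2 = -(W ω * p⁻¹) := by
      simp only [hW, hk]; field_simp; ring
    have e2 : -(f ω - p * ξ i₀ ω) / p = -U ω := by
      simp only [hU]; field_simp
    rw [e1, e2, abs_neg, abs_mul, abs_inv]
    simp only [gaussianPDFReal, NNReal.coe_one, mul_one, sub_zero, neg_sq]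
    ring
  have hWU : AEMeasurable (fun ω => ENNReal.ofReal (|W ω| * Real.exp (-(U ω) ^ 2 / 2))) P :=
    (by fun_prop : Measurable fun q : ℝ × ℝ =>
      ENNReal.ofReal (|q.2| * Real.exp (-q.1 ^ 2 / 2))).comp_aemeasurable hUW.aemeasurable
  refine (lintegral_congr hpt).trans ?_
  rw [lintegral_const_mul'' _ hWU, lintegral_abs_mul_exp_neg_sq hUW hU0 hW0,
    ← ENNReal.ofReal_mul (by positivity), cUU, cWW, cUW]
  congr 1
  have e3 : (w - 2 * k * c + k ^ 2 * v) * (1 + (v / p ^ 2 - 1)) - ((c - k * v) / p) ^ 2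
      = (w * v - c ^ 2) / |p| ^ 2 := by
    rw [sq_abs]; field_simp; ring
  have habs : 0 < |p| := abs_pos.2 hp0
  have e4 : Real.sqrt ((w * v - c ^ 2) / |p| ^ 2) = Real.sqrt (w * v - c ^ 2) / |p| := by
    rw [Real.sqrt_div' _ (by positivity), Real.sqrt_sq (abs_nonneg p)]
  rw [e3, e4, ← sq_abs p, Real.sqrt_div (by norm_num), Real.sqrt_mul (by norm_num)]
  have hv0 : v ≠ 0 := hv.ne'
  have hpi : Real.sqrt Real.pi * Real.sqrt Real.pi = Real.pi := Real.mul_self_sqrt Real.pi_pos.le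
  have hpi0 : Real.sqrt Real.pi ≠ 0 := by positivity
  rw [show (1 : ℝ) / Real.pi = 1 / (Real.sqrt Real.pi * Real.sqrt Real.pi) by rw [hpi],
    show 1 + (v / |p| ^ 2 - 1) = v / |p| ^ 2 by ring]
  field_simp

/-- The Kac–Rice formula for a finite linear combination of `C¹` functions with jointly Gaussian
coefficients. One of the coefficients is normalized, and the covariance of the process with it
vanishes on a countable set only. Conditioning on the part of the process that is independent of
this coefficient reduces the formula to the area formula; no limit over levels is needed and
multiple zeros require no separate treatment. -/
theorem lintegral_zeroCount_gaussian (hm : ∀ i, Measurable (ξ i))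
    (hξ : HasGaussianLaw (fun ω i => ξ i ω) P) (h0 : ∀ i, P[ξ i] = 0)
    (he : ∀ i x, HasDerivAt (e i) (e' i x) x) (he' : ∀ i, Continuous (e' i))
    {i₀ : ι} (hi₀ : cov[ξ i₀, ξ i₀; P] = 1)
    (hZ : {x | ∑ i, cov[ξ i, ξ i₀; P] * e i x = 0}.Countable)
    (hv : ∀ x, 0 < cov[fun ω => ∑ i, ξ i ω * e i x, fun ω => ∑ i, ξ i ω * e i x; P]) (s t : ℝ) :
    ∫⁻ ω, zeroCount (fun x => ∑ i, ξ i ω * e i x) s t ∂P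
      = ∫⁻ x in Set.Icc s t, ENNReal.ofReal (1 / Real.pi *
        (Real.sqrt (cov[fun ω => ∑ i, ξ i ω * e' i x, fun ω => ∑ i, ξ i ω * e' i x; P]
            * cov[fun ω => ∑ i, ξ i ω * e i x, fun ω => ∑ i, ξ i ω * e i x; P]
            - cov[fun ω => ∑ i, ξ i ω * e i x, fun ω => ∑ i, ξ i ω * e' i x; P] ^ 2)
          / cov[fun ω => ∑ i, ξ i ω * e i x, fun ω => ∑ i, ξ i ω * e i x; P])) := by
  have := hξ.isProbabilityMeasure
  have hec : ∀ i, Continuous (e i) := fun i =>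
    continuous_iff_continuousAt.2 fun x => (he i x).continuousAt
  have hξ2 : ∀ i, MemLp (ξ i) 2 P := fun i => (hξ.eval i).memLp_two
  set r : ι → ℝ := fun i => cov[ξ i, ξ i₀; P] with hr
  set η : ι → Ω → ℝ := fun i ω => ξ i ω - r i * ξ i₀ ω with hη
  have hcov : ∀ w : ι → ℝ, cov[fun ω => ∑ i, ξ i ω * w i, ξ i₀; P] = ∑ i, r i * w i := fun w => by
    rw [covariance_fun_sum_left (fun i => (hξ2 i).mul_const _) (hξ2 i₀)]
    simp [covariance_mul_const_left, hr]
  have hsplit : ∀ (w : ι → ℝ) ω,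
      ∑ i, η i ω * w i = ∑ i, ξ i ω * w i - (∑ i, r i * w i) * ξ i₀ ω := fun w ω => by
    simp only [hη, sub_mul, Finset.sum_sub_distrib, Finset.sum_mul]
    congr 1
    exact Finset.sum_congr rfl fun i _ => by ring
  set φ : ℝ → ℝ := fun x => ∑ i, r i * e i x with hφ
  set φ' : ℝ → ℝ := fun x => ∑ i, r i * e' i x with hφ'
  have hφd : ∀ x, HasDerivAt φ (φ' x) x := fun x =>
    HasDerivAt.fun_sum fun i _ => (he i x).const_mul (r i)
  have hφ'c : Continuous φ' := continuous_finsetSum _ fun i _ => continuous_const.mul (he' i)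
  have hφc : Continuous φ := continuous_iff_continuousAt.2 fun x => (hφd x).continuousAt
  have hηm : Measurable fun ω i => η i ω :=
    measurable_pi_lambda _ fun i => (hm i).sub ((hm i₀).const_mul _)
  -- independence of the pinned coefficient and the remainder
  have hind : IndepFun (ξ i₀) (fun ω i => η i ω) P := by
    have hG : HasGaussianLaw (fun ω => ((fun _ : Unit => ξ i₀ ω), fun i => η i ω)) P := by
      have := hξ.map_fun ((ContinuousLinearMap.pi fun _ : Unit =>
          (ContinuousLinearMap.proj i₀ : (ι → ℝ) →L[ℝ] ℝ)).prod
        (ContinuousLinearMap.pi fun i => ContinuousLinearMap.proj i -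
          r i • (ContinuousLinearMap.proj i₀ : (ι → ℝ) →L[ℝ] ℝ)))
      exact this
    have h1 := HasGaussianLaw.indepFun_of_covariance_eval (X := fun _ : Unit => ξ i₀) hG
      (fun _ i => by
        rw [hη, covariance_fun_sub_right (hξ2 i₀) (hξ2 i) ((hξ2 i₀).const_mul _),
          covariance_const_mul_right, hi₀, covariance_comm]
        simp [hr])
    exact h1.comp (measurable_pi_apply ()) measurable_id
  have hlawX : P.map (ξ i₀) = gaussianReal 0 1 := by
    rw [(hξ.eval i₀).map_eq_gaussianReal, h0, ← covariance_self (hm i₀).aemeasurable, hi₀]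
    simp
  set κ := P.map (fun ω i => η i ω) with hκ
  have : IsProbabilityMeasure κ := Measure.isProbabilityMeasure_map hηm.aemeasurable
  have hjoint : P.map (fun ω => (ξ i₀ ω, fun i => η i ω)) = (gaussianReal 0 1).prod κ := by
    rw [(indepFun_iff_map_prod_eq_prod_map_map (hm i₀).aemeasurable hηm.aemeasurable).1 hind,
      hlawX]
  set N : ℝ × (ι → ℝ) → ℝ≥0∞ := fun q =>
    zeroCount (fun x => q.1 * φ x + ∑ i, q.2 i * e i x) s t with hN
  have hNm : Measurable N := by
    refine measurable_zeroCount (f := fun (q : ℝ × (ι → ℝ)) x => q.1 * φ x + ∑ i, q.2 i * e i x)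
      (fun q => ?_) (fun x => ?_) s t
    · exact (continuous_const.mul hφc).add
        (continuous_finsetSum _ fun i _ => continuous_const.mul (hec i))
    · fun_prop
  have step1 : ∫⁻ ω, zeroCount (fun x => ∑ i, ξ i ω * e i x) s t ∂P
      = ∫⁻ y, ∫⁻ X, N (X, y) ∂(gaussianReal 0 1) ∂κ := by
    rw [← lintegral_prod_symm _ hNm.aemeasurable, ← hjoint, lintegral_map hNm ((hm i₀).prodMk hηm)]
    refine lintegral_congr fun ω => ?_
    simp only [hN]
    congr 1
    ext x
    rw [hsplit]
    ring
  have hgood : ∀ᵐ y ∂κ, ∀ x, φ x = 0 → ∑ i, y i * e i x ≠ 0 := by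
    have : ∀ᵐ y ∂κ, ∀ x ∈ {x | φ x = 0}, ∑ i, y i * e i x ≠ 0 := by
      rw [ae_ball_iff hZ]
      intro x hx
      have hmeas : MeasurableSet {y : ι → ℝ | ∑ i, y i * e i x ≠ 0} :=
        ((by fun_prop : Measurable fun y : ι → ℝ => ∑ i, y i * e i x)
          (measurableSet_singleton 0)).compl
      rw [hκ, ae_map_iff hηm.aemeasurable hmeas]
      have hfl : HasGaussianLaw (fun ω => ∑ i, ξ i ω * e i x) P := by
        have := hξ.map_fun (dotCLM fun i => e i x)
        simpa [dotCLM_apply] using this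
      have hmap := hfl.map_eq_gaussianReal
      have hvar : (Var[fun ω => ∑ i, ξ i ω * e i x; P]).toNNReal ≠ 0 := by
        rw [← covariance_self hfl.aemeasurable]
        simpa using hv x
      have hnull : P.map (fun ω => ∑ i, ξ i ω * e i x) {0} = 0 := by
        rw [hmap]
        exact gaussianReal_absolutelyContinuous _ hvar (by simp)
      rw [Measure.map_apply_of_aemeasurable hfl.aemeasurable (measurableSet_singleton 0)] at hnull
      filter_upwards [measure_eq_zero_iff_ae_notMem.1 hnull] with ω hω
      rw [hsplit, show ∑ i, r i * e i x = 0 from hx, zero_mul, sub_zero]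
      exact hω
    simpa using this
  set U : Set ℝ := Set.Icc s t ∩ {x | φ x ≠ 0} with hU
  have hUm : MeasurableSet U :=
    measurableSet_Icc.inter (hφc.measurable (measurableSet_singleton 0)).compl
  set G : (ι → ℝ) → ℝ → ℝ≥0∞ := fun y x =>
    ENNReal.ofReal |-((∑ i, y i * e' i x) * φ x - (∑ i, y i * e i x) * φ' x) / φ x ^ 2| *
      gaussianPDF 0 1 (-(∑ i, y i * e i x) / φ x) with hG
  have hGm : Measurable (Function.uncurry G) := by
    have h1 : Measurable fun q : (ι → ℝ) × ℝ => ∑ i, q.1 i * e i q.2 :=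
      Finset.measurable_fun_sum _ fun i _ =>
        ((measurable_pi_apply i).comp measurable_fst).mul ((hec i).measurable.comp measurable_snd)
    have h2 : Measurable fun q : (ι → ℝ) × ℝ => ∑ i, q.1 i * e' i q.2 :=
      Finset.measurable_fun_sum _ fun i _ =>
        ((measurable_pi_apply i).comp measurable_fst).mul ((he' i).measurable.comp measurable_snd)
    have h3 : Measurable fun q : (ι → ℝ) × ℝ => φ q.2 := hφc.measurable.comp measurable_snd
    have h4 : Measurable fun q : (ι → ℝ) × ℝ => φ' q.2 := hφ'c.measurable.comp measurable_snd
    exact (((h2.mul h3).sub (h1.mul h4)).neg.div (h3.pow_const 2)).abs.ennreal_ofReal.mul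
      ((measurable_gaussianPDF 0 1).comp (h1.neg.div h3))
  have step2 : ∫⁻ y, ∫⁻ X, N (X, y) ∂(gaussianReal 0 1) ∂κ = ∫⁻ y, (∫⁻ x in U, G y x) ∂κ := by
    refine lintegral_congr_ae ?_
    filter_upwards [hgood] with y hy
    exact lintegral_zeroCount_gaussianReal hφd hφ'c
      (fun x => HasDerivAt.fun_sum fun i _ => (he i x).const_mul (y i))
      (continuous_finsetSum _ fun i _ => continuous_const.mul (he' i)) hy s t
  rw [step1, step2, lintegral_lintegral_swap hGm.aemeasurable]
  have hUI : (U : Set ℝ) =ᵐ[volume] Set.Icc s t := by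
    have hZ0 : volume {x | φ x = 0} = 0 := hZ.measure_zero _
    filter_upwards [measure_eq_zero_iff_ae_notMem.1 hZ0] with x hx
    exact propext ⟨fun h => h.1, fun h => ⟨h, hx⟩⟩
  rw [← setLIntegral_congr hUI]
  refine setLIntegral_congr_fun hUm fun x hx => ?_
  have hGx : Measurable fun y => G y x := hGm.of_uncurry_right
  refine (lintegral_map hGx hηm).trans ?_
  rw [← lintegral_density hξ h0 hi₀ (fun i => e i x) (fun i => e' i x)
    (hv x) (hcov _) (hcov _) hx.2]
  refine lintegral_congr fun ω => ?_
  simp only [hG, hsplit, hφ, hφ']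

end KacRice

/-! ### Trigonometric sums -/

/-- The cosine sum `∑_{j=1}^n A_j cos (j u)`, the coefficient with number `j = k + 1` being stored
at index `k`. -/
noncomputable def cosSum (A : ℕ → ℝ) (n : ℕ) (u : ℝ) : ℝ :=
  ∑ k ∈ Finset.range n, A k * Real.cos (((k + 1 : ℕ) : ℝ) * u)

/-- The sine sum `∑_{j=1}^n A_j sin (j u)`, indexed like `cosSum`. -/
noncomputable def sinSum (A : ℕ → ℝ) (n : ℕ) (u : ℝ) : ℝ :=
  ∑ k ∈ Finset.range n, A k * Real.sin (((k + 1 : ℕ) : ℝ) * u)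

/-- The coefficients `1, 2, 3, …`. -/
def succCoeff (k : ℕ) : ℝ := ((k + 1 : ℕ) : ℝ)

/-- The squared modulus `|∑_{j=1}^n e^{iju}|²` of the Dirichlet sum. -/
noncomputable def kerSq (n : ℕ) (u : ℝ) : ℝ :=
  cosSum (fun _ => 1) n u ^ 2 + sinSum (fun _ => 1) n u ^ 2

/-- The squared modulus `|∑_{j=1}^n j e^{iju}|²` of the derivative of the Dirichlet sum. -/
noncomputable def kerDerivSq (n : ℕ) (u : ℝ) : ℝ :=
  cosSum succCoeff n u ^ 2 + sinSum succCoeff n u ^ 2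

/-- Half the derivative of `kerSq`. -/
noncomputable def kerCross (n : ℕ) (u : ℝ) : ℝ :=
  sinSum (fun _ => 1) n u * cosSum succCoeff n u - cosSum (fun _ => 1) n u * sinSum succCoeff n u

@[fun_prop]
lemma continuous_cosSum (A : ℕ → ℝ) (n : ℕ) : Continuous (cosSum A n) := by
  unfold cosSum; fun_prop

@[fun_prop]
lemma continuous_sinSum (A : ℕ → ℝ) (n : ℕ) : Continuous (sinSum A n) := by
  unfold sinSum; fun_prop

@[fun_prop]
lemma continuous_kerSq (n : ℕ) : Continuous (kerSq n) := by
  unfold kerSq; fun_prop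

@[fun_prop]
lemma continuous_kerDerivSq (n : ℕ) : Continuous (kerDerivSq n) := by
  unfold kerDerivSq; fun_prop

@[fun_prop]
lemma continuous_kerCross (n : ℕ) : Continuous (kerCross n) := by
  unfold kerCross; fun_prop

lemma kerSq_nonneg (n : ℕ) (u : ℝ) : 0 ≤ kerSq n u := by unfold kerSq; positivity

lemma kerDerivSq_nonneg (n : ℕ) (u : ℝ) : 0 ≤ kerDerivSq n u := by unfold kerDerivSq; positivity

lemma hasDerivAt_kerSq (n : ℕ) (u : ℝ) : HasDerivAt (kerSq n) (2 * kerCross n u) u := by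
  have hc : HasDerivAt (cosSum (fun _ => 1) n) (-sinSum succCoeff n u) u := by
    unfold cosSum sinSum
    rw [← Finset.sum_neg_distrib]
    refine HasDerivAt.fun_sum fun k _ => ?_
    have := ((hasDerivAt_id u).const_mul (((k + 1 : ℕ) : ℝ))).cos.const_mul 1
    refine this.congr_deriv ?_
    simp only [succCoeff, id]
    ring
  have hs : HasDerivAt (sinSum (fun _ => 1) n) (cosSum succCoeff n u) u := by
    unfold cosSum sinSum
    refine HasDerivAt.fun_sum fun k _ => ?_
    have := ((hasDerivAt_id u).const_mul (((k + 1 : ℕ) : ℝ))).sin.const_mul 1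
    refine this.congr_deriv ?_
    simp only [succCoeff, id]
    ring
  refine ((hc.pow 2).add (hs.pow 2)).congr_deriv ?_
  unfold kerCross
  push_cast
  ring

lemma integral_kerCross (n : ℕ) (p q : ℝ) :
    ∫ u in p..q, kerCross n u = (kerSq n q - kerSq n p) / 2 := by
  have h := intervalIntegral.integral_eq_sub_of_hasDerivAt
    (fun u _ => hasDerivAt_kerSq n u)
    ((by fun_prop : Continuous fun u => 2 * kerCross n u).intervalIntegrable p q)
  rw [intervalIntegral.integral_const_mul] at h
  linarith

lemma cosSum_two_pi_sub (A : ℕ → ℝ) (n : ℕ) (u : ℝ) :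
    cosSum A n (2 * Real.pi - u) = cosSum A n u := by
  refine Finset.sum_congr rfl fun k _ => ?_
  rw [mul_sub, Real.cos_nat_mul_two_pi_sub]

lemma sinSum_two_pi_sub (A : ℕ → ℝ) (n : ℕ) (u : ℝ) :
    sinSum A n (2 * Real.pi - u) = -sinSum A n u := by
  unfold sinSum
  rw [← Finset.sum_neg_distrib]
  refine Finset.sum_congr rfl fun k _ => ?_
  rw [mul_sub, Real.sin_nat_mul_two_pi_sub]
  ring

lemma two_sin_half_mul_cosSum (n : ℕ) (u : ℝ) :
    2 * Real.sin (u / 2) * cosSum (fun _ => 1) n u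
      = Real.sin (n * u + u / 2) - Real.sin (u / 2) := by
  induction n with
  | zero => simp [cosSum]
  | succ n ih =>
    unfold cosSum at ih ⊢
    rw [Finset.sum_range_succ, mul_add, ih]
    push_cast
    rw [show ((n : ℝ) + 1) * u + u / 2 = (n + 1) * u + u / 2 from rfl, Real.sin_add ((n + 1) * u),
      show (n : ℝ) * u + u / 2 = (n + 1) * u - u / 2 by ring, Real.sin_sub]
    ring

lemma two_sin_half_mul_sinSum (n : ℕ) (u : ℝ) :
    2 * Real.sin (u / 2) * sinSum (fun _ => 1) n u
      = Real.cos (u / 2) - Real.cos (n * u + u / 2) := by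
  induction n with
  | zero => simp [sinSum]
  | succ n ih =>
    unfold sinSum at ih ⊢
    rw [Finset.sum_range_succ, mul_add, ih]
    push_cast
    rw [Real.cos_add (((n : ℝ) + 1) * u),
      show (n : ℝ) * u + u / 2 = (n + 1) * u - u / 2 by ring, Real.cos_sub]
    ring

/-- The closed form of the Fejér-type kernel. -/
lemma kerSq_mul_sin_sq (n : ℕ) (u : ℝ) :
    kerSq n u * Real.sin (u / 2) ^ 2 = Real.sin (n * u / 2) ^ 2 := by
  have h1 := two_sin_half_mul_cosSum n u
  have h2 := two_sin_half_mul_sinSum n u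
  have e : 4 * (kerSq n u * Real.sin (u / 2) ^ 2)
      = (2 * Real.sin (u / 2) * cosSum (fun _ => 1) n u) ^ 2
        + (2 * Real.sin (u / 2) * sinSum (fun _ => 1) n u) ^ 2 := by
    unfold kerSq; ring
  rw [h1, h2, Real.sin_add, Real.cos_add] at e
  have e2 : Real.sin (n * u / 2) ^ 2 = (1 - Real.cos (n * u)) / 2 := by
    rw [Real.sin_sq_eq_half_sub]
    ring_nf
  rw [e2]
  have a1 := Real.sin_sq_add_cos_sq (u / 2)
  have a2 := Real.sin_sq_add_cos_sq (n * u)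
  linear_combination (1 / 4) * e + (1 / 4) * (1 + (Real.sin (n * u) ^ 2 + Real.cos (n * u) ^ 2)
    - 2 * Real.cos (n * u)) * a1 + (1 / 4) * a2

lemma sin_sq_le_kerSq (n : ℕ) (u : ℝ) : Real.sin (n * u / 2) ^ 2 ≤ kerSq n u := by
  rw [← kerSq_mul_sin_sq]
  exact mul_le_of_le_one_right (kerSq_nonneg n u) (Real.sin_sq_le_one _)

lemma kerSq_le (n : ℕ) {u : ℝ} (hu : Real.sin (u / 2) ≠ 0) :
    kerSq n u ≤ 1 / Real.sin (u / 2) ^ 2 := by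
  rw [le_div_iff₀ (by positivity), kerSq_mul_sin_sq]
  exact Real.sin_sq_le_one _

/-- Summation by parts for the differentiated Dirichlet sum. -/
lemma two_sin_half_mul_cosSum_succCoeff (n : ℕ) (u : ℝ) :
    2 * Real.sin (u / 2) * cosSum succCoeff n u = n * Real.sin (n * u + u / 2)
      - ∑ k ∈ Finset.range n, Real.sin (k * u + u / 2) := by
  induction n with
  | zero => simp [cosSum]
  | succ n ih =>
    unfold cosSum at ih ⊢
    rw [Finset.sum_range_succ, mul_add, ih, Finset.sum_range_succ]
    simp only [succCoeff]
    push_cast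
    rw [Real.sin_add (((n : ℝ) + 1) * u),
      show (n : ℝ) * u + u / 2 = (n + 1) * u - u / 2 by ring, Real.sin_sub]
    ring

lemma two_sin_half_mul_sinSum_succCoeff (n : ℕ) (u : ℝ) :
    2 * Real.sin (u / 2) * sinSum succCoeff n u = -(n * Real.cos (n * u + u / 2))
      + ∑ k ∈ Finset.range n, Real.cos (k * u + u / 2) := by
  induction n with
  | zero => simp [sinSum]
  | succ n ih =>
    unfold sinSum at ih ⊢
    rw [Finset.sum_range_succ, mul_add, ih, Finset.sum_range_succ]
    simp only [succCoeff]
    push_cast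
    rw [Real.cos_add (((n : ℝ) + 1) * u),
      show (n : ℝ) * u + u / 2 = (n + 1) * u - u / 2 by ring, Real.cos_sub]
    ring

lemma two_sin_half_mul_sum_sin (n : ℕ) (u : ℝ) :
    2 * Real.sin (u / 2) * ∑ k ∈ Finset.range n, Real.sin (k * u + u / 2)
      = 1 - Real.cos (n * u) := by
  induction n with
  | zero => simp
  | succ n ih =>
    rw [Finset.sum_range_succ, mul_add, ih]
    push_cast
    rw [show ((n : ℝ) + 1) * u = (n * u + u / 2) + u / 2 by ring, Real.cos_add (n * u + u / 2),
      show (n : ℝ) * u = (n * u + u / 2) - u / 2 by ring, Real.cos_sub]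
    ring_nf

lemma two_sin_half_mul_sum_cos (n : ℕ) (u : ℝ) :
    2 * Real.sin (u / 2) * ∑ k ∈ Finset.range n, Real.cos (k * u + u / 2)
      = Real.sin (n * u) := by
  induction n with
  | zero => simp
  | succ n ih =>
    rw [Finset.sum_range_succ, mul_add, ih]
    push_cast
    rw [show ((n : ℝ) + 1) * u = (n * u + u / 2) + u / 2 by ring, Real.sin_add (n * u + u / 2),
      show (n : ℝ) * u = (n * u + u / 2) - u / 2 by ring, Real.sin_sub]
    ring_nf

lemma four_sin_sq_mul_kerDerivSq (n : ℕ) (u : ℝ) :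
    4 * Real.sin (u / 2) ^ 2 * kerDerivSq n u
      = (n * Real.sin (n * u + u / 2) - ∑ k ∈ Finset.range n, Real.sin (k * u + u / 2)) ^ 2
        + (n * Real.cos (n * u + u / 2) - ∑ k ∈ Finset.range n, Real.cos (k * u + u / 2)) ^ 2 := by
  rw [← two_sin_half_mul_cosSum_succCoeff]
  have h := two_sin_half_mul_sinSum_succCoeff n u
  have h2 : (n * Real.cos (n * u + u / 2) - ∑ k ∈ Finset.range n, Real.cos (k * u + u / 2))
      = -(2 * Real.sin (u / 2) * sinSum succCoeff n u) := by rw [h]; ring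
  rw [h2]
  unfold kerDerivSq
  ring

lemma kerDerivSq_le (n : ℕ) {u : ℝ} (hu : Real.sin (u / 2) ≠ 0) :
    kerDerivSq n u ≤ 2 * n ^ 2 * (1 / Real.sin (u / 2) ^ 2) := by
  rw [mul_one_div, le_div_iff₀ (by positivity)]
  have h := four_sin_sq_mul_kerDerivSq n u
  have hP : |∑ k ∈ Finset.range n, Real.sin (k * u + u / 2)| ≤ n := by
    refine (Finset.abs_sum_le_sum_abs _ _).trans ?_
    refine (Finset.sum_le_sum fun k _ => Real.abs_sin_le_one _).trans ?_
    simp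
  have hQ : |∑ k ∈ Finset.range n, Real.cos (k * u + u / 2)| ≤ n := by
    refine (Finset.abs_sum_le_sum_abs _ _).trans ?_
    refine (Finset.sum_le_sum fun k _ => Real.abs_cos_le_one _).trans ?_
    simp
  set p := ∑ k ∈ Finset.range n, Real.sin (k * u + u / 2)
  set q := ∑ k ∈ Finset.range n, Real.cos (k * u + u / 2)
  have hp2 : p ^ 2 ≤ (n : ℝ) ^ 2 := sq_le_sq' (abs_le.1 hP).1 (abs_le.1 hP).2
  have hq2 : q ^ 2 ≤ (n : ℝ) ^ 2 := sq_le_sq' (abs_le.1 hQ).1 (abs_le.1 hQ).2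
  have a := Real.sin_sq_add_cos_sq (n * u + u / 2)
  set x := Real.sin (n * u + u / 2)
  set y := Real.cos (n * u + u / 2)
  have b : (n * x) ^ 2 + (n * y) ^ 2 = (n : ℝ) ^ 2 := by
    rw [mul_pow, mul_pow, ← mul_add, a, mul_one]
  nlinarith [sq_nonneg (n * x + p), sq_nonneg (n * y + q)]

lemma abs_four_sin_sq_mul_kerDerivSq_sub (n : ℕ) {u : ℝ} (hu : Real.sin (u / 2) ≠ 0) :
    |4 * Real.sin (u / 2) ^ 2 * kerDerivSq n u - n ^ 2|
      ≤ 2 * (1 / |Real.sin (u / 2)|) ^ 2 + 4 * n * (1 / |Real.sin (u / 2)|) := by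
  have h := four_sin_sq_mul_kerDerivSq n u
  have hs : 0 < |Real.sin (u / 2)| := abs_pos.2 hu
  have hP : |∑ k ∈ Finset.range n, Real.sin (k * u + u / 2)| ≤ 1 / |Real.sin (u / 2)| := by
    rw [le_div_iff₀ hs, ← abs_mul]
    have := two_sin_half_mul_sum_sin n u
    rw [abs_le]
    constructor <;> nlinarith [Real.cos_le_one (n * u), Real.neg_one_le_cos (n * u)]
  have hQ : |∑ k ∈ Finset.range n, Real.cos (k * u + u / 2)| ≤ 1 / |Real.sin (u / 2)| := by
    rw [le_div_iff₀ hs, ← abs_mul]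
    have := two_sin_half_mul_sum_cos n u
    rw [abs_le]
    constructor <;> nlinarith [Real.sin_le_one (n * u), Real.neg_one_le_sin (n * u)]
  have a := Real.sin_sq_add_cos_sq (n * u + u / 2)
  have hx := Real.abs_sin_le_one (n * u + u / 2)
  have hy := Real.abs_cos_le_one (n * u + u / 2)
  set p := ∑ k ∈ Finset.range n, Real.sin (k * u + u / 2)
  set q := ∑ k ∈ Finset.range n, Real.cos (k * u + u / 2)
  set x := Real.sin (n * u + u / 2)
  set y := Real.cos (n * u + u / 2)
  set m := 1 / |Real.sin (u / 2)| with hm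
  have e : 4 * Real.sin (u / 2) ^ 2 * kerDerivSq n u - n ^ 2
      = p ^ 2 + q ^ 2 - 2 * n * (x * p + y * q) := by
    rw [h]; linear_combination (n : ℝ) ^ 2 * a
  have hm0 : 0 ≤ m := by positivity
  have hp2 : p ^ 2 ≤ m ^ 2 := sq_le_sq' (abs_le.1 hP).1 (abs_le.1 hP).2
  have hq2 : q ^ 2 ≤ m ^ 2 := sq_le_sq' (abs_le.1 hQ).1 (abs_le.1 hQ).2
  have hxp : |x * p| ≤ m := by
    rw [abs_mul]; exact (mul_le_mul hx hP (abs_nonneg _) zero_le_one).trans (by rw [one_mul])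
  have hyq : |y * q| ≤ m := by
    rw [abs_mul]; exact (mul_le_mul hy hQ (abs_nonneg _) zero_le_one).trans (by rw [one_mul])
  rw [e]
  have h1 : |x * p + y * q| ≤ 2 * m := (abs_add_le _ _).trans (by linarith)
  have h2 : |2 * n * (x * p + y * q)| ≤ 4 * n * m := by
    rw [abs_mul, abs_of_nonneg (by positivity)]
    calc 2 * (n : ℝ) * |x * p + y * q| ≤ 2 * n * (2 * m) := by gcongr
      _ = 4 * n * m := by ring
  calc |p ^ 2 + q ^ 2 - 2 * n * (x * p + y * q)|
      ≤ |p ^ 2 + q ^ 2| + |2 * n * (x * p + y * q)| := abs_sub _ _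
    _ ≤ 2 * m ^ 2 + 4 * n * m := by
      rw [abs_of_nonneg (add_nonneg (sq_nonneg p) (sq_nonneg q))]
      linarith

lemma kerSq_ge_of_mem_Icc {n : ℕ} {u : ℝ} (h0 : 0 ≤ u) (h1 : n * u ≤ 1) :
    (n : ℝ) ^ 2 / 4 ≤ kerSq n u := by
  have hc : (n : ℝ) / 2 ≤ cosSum (fun _ => 1) n u := by
    have : ∀ k ∈ Finset.range n, (1 : ℝ) / 2 ≤ 1 * Real.cos (((k + 1 : ℕ) : ℝ) * u) := by
      intro k hk
      have hk' : ((k + 1 : ℕ) : ℝ) ≤ n := by exact_mod_cast Finset.mem_range.1 hk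
      have hle : ((k + 1 : ℕ) : ℝ) * u ≤ 1 := (mul_le_mul_of_nonneg_right hk' h0).trans h1
      have hge : 0 ≤ ((k + 1 : ℕ) : ℝ) * u := by positivity
      have := Real.one_sub_sq_div_two_le_cos (x := ((k + 1 : ℕ) : ℝ) * u)
      nlinarith
    have := Finset.sum_le_sum this
    simp only [Finset.sum_const, Finset.card_range, nsmul_eq_mul] at this
    unfold cosSum
    linarith
  unfold kerSq
  nlinarith [sq_nonneg (sinSum (fun _ => 1) n u), (Nat.cast_nonneg n : (0 : ℝ) ≤ n)]

/-! ### The correlation function and its integrals -/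

lemma integral_cos_int_mul {α : ℝ} (hα : α ≠ 0) (j : ℤ) (x : ℝ) :
    ∫ u in (x - α)..(x + α), Real.cos (j * u)
      = 2 * α * (crenelCorrelation α j.natAbs * Real.cos (j * x)) := by
  rcases eq_or_ne j 0 with rfl | hj
  · simp [crenelCorrelation]; ring
  · have hj' : (j : ℝ) ≠ 0 := by exact_mod_cast hj
    have hodd : Real.sin ((j.natAbs : ℝ) * α) / ((j.natAbs : ℝ) * α)
        = Real.sin (j * α) / (j * α) := by
      rw [Nat.cast_natAbs, Int.cast_abs]
      rcases abs_cases (j : ℝ) with ⟨h, -⟩ | ⟨h, -⟩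
      · rw [h]
      · rw [h, neg_mul, Real.sin_neg, neg_div_neg_eq]
    rw [crenelCorrelation, if_neg (by simpa using hj), hodd,
      intervalIntegral.integral_comp_mul_left (fun u => Real.cos u) hj', integral_cos, mul_sub,
      mul_add, Real.sin_add, Real.sin_sub, smul_eq_mul]
    field_simp
    ring

lemma integral_sin_int_mul {α : ℝ} (hα : α ≠ 0) (j : ℤ) (x : ℝ) :
    ∫ u in (x - α)..(x + α), Real.sin (j * u)
      = 2 * α * (crenelCorrelation α j.natAbs * Real.sin (j * x)) := by
  rcases eq_or_ne j 0 with rfl | hj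
  · simp
  · have hj' : (j : ℝ) ≠ 0 := by exact_mod_cast hj
    have hodd : Real.sin ((j.natAbs : ℝ) * α) / ((j.natAbs : ℝ) * α)
        = Real.sin (j * α) / (j * α) := by
      rw [Nat.cast_natAbs, Int.cast_abs]
      rcases abs_cases (j : ℝ) with ⟨h, -⟩ | ⟨h, -⟩
      · rw [h]
      · rw [h, neg_mul, Real.sin_neg, neg_div_neg_eq]
    rw [crenelCorrelation, if_neg (by simpa using hj), hodd,
      intervalIntegral.integral_comp_mul_left (fun u => Real.sin u) hj', integral_sin, mul_sub,
      mul_add, Real.cos_add, Real.cos_sub, smul_eq_mul]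
    field_simp
    ring

lemma sum_sum_correlation_cos {α : ℝ} (hα : α ≠ 0) (A B : ℕ → ℝ) (n : ℕ) (x : ℝ) :
    ∑ k ∈ Finset.range n, ∑ l ∈ Finset.range n, crenelCorrelation α ((k : ℤ) - (l : ℤ)).natAbs *
        (A k * B l * (Real.cos (((k + 1 : ℕ) : ℝ) * x) * Real.cos (((l + 1 : ℕ) : ℝ) * x)
          + Real.sin (((k + 1 : ℕ) : ℝ) * x) * Real.sin (((l + 1 : ℕ) : ℝ) * x)))
      = 1 / (2 * α) * ∫ u in (x - α)..(x + α),
          (cosSum A n u * cosSum B n u + sinSum A n u * sinSum B n u) := by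
  have key : ∀ u, cosSum A n u * cosSum B n u + sinSum A n u * sinSum B n u
      = ∑ k ∈ Finset.range n, ∑ l ∈ Finset.range n,
        A k * B l * Real.cos ((((k : ℤ) - (l : ℤ) : ℤ) : ℝ) * u) := by
    intro u
    unfold cosSum sinSum
    rw [Finset.sum_mul_sum, Finset.sum_mul_sum, ← Finset.sum_add_distrib]
    refine Finset.sum_congr rfl fun k _ => ?_
    rw [← Finset.sum_add_distrib]
    refine Finset.sum_congr rfl fun l _ => ?_
    have : (((k : ℤ) - (l : ℤ) : ℤ) : ℝ) * u
        = ((k + 1 : ℕ) : ℝ) * u - ((l + 1 : ℕ) : ℝ) * u := by push_cast; ring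
    rw [this, Real.cos_sub]
    ring
  simp_rw [key]
  rw [intervalIntegral.integral_finsetSum fun k _ =>
    (by fun_prop : Continuous _).intervalIntegrable _ _, Finset.mul_sum]
  refine Finset.sum_congr rfl fun k _ => ?_
  rw [intervalIntegral.integral_finsetSum fun l _ =>
    (by fun_prop : Continuous _).intervalIntegrable _ _, Finset.mul_sum]
  refine Finset.sum_congr rfl fun l _ => ?_
  rw [intervalIntegral.integral_const_mul, integral_cos_int_mul hα, ← Real.cos_sub]
  have : (((k : ℤ) - (l : ℤ) : ℤ) : ℝ) * x
      = ((k + 1 : ℕ) : ℝ) * x - ((l + 1 : ℕ) : ℝ) * x := by push_cast; ring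
  rw [this]
  field_simp

lemma sum_sum_correlation_sin {α : ℝ} (hα : α ≠ 0) (A B : ℕ → ℝ) (n : ℕ) (x : ℝ) :
    ∑ k ∈ Finset.range n, ∑ l ∈ Finset.range n, crenelCorrelation α ((k : ℤ) - (l : ℤ)).natAbs *
        (A k * B l * (Real.sin (((k + 1 : ℕ) : ℝ) * x) * Real.cos (((l + 1 : ℕ) : ℝ) * x)
          - Real.cos (((k + 1 : ℕ) : ℝ) * x) * Real.sin (((l + 1 : ℕ) : ℝ) * x)))
      = 1 / (2 * α) * ∫ u in (x - α)..(x + α),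
          (sinSum A n u * cosSum B n u - cosSum A n u * sinSum B n u) := by
  have key : ∀ u, sinSum A n u * cosSum B n u - cosSum A n u * sinSum B n u
      = ∑ k ∈ Finset.range n, ∑ l ∈ Finset.range n,
        A k * B l * Real.sin ((((k : ℤ) - (l : ℤ) : ℤ) : ℝ) * u) := by
    intro u
    unfold cosSum sinSum
    rw [Finset.sum_mul_sum, Finset.sum_mul_sum, ← Finset.sum_sub_distrib]
    refine Finset.sum_congr rfl fun k _ => ?_
    rw [← Finset.sum_sub_distrib]
    refine Finset.sum_congr rfl fun l _ => ?_
    have : (((k : ℤ) - (l : ℤ) : ℤ) : ℝ) * u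
        = ((k + 1 : ℕ) : ℝ) * u - ((l + 1 : ℕ) : ℝ) * u := by push_cast; ring
    rw [this, Real.sin_sub]
    ring
  simp_rw [key]
  rw [intervalIntegral.integral_finsetSum fun k _ =>
    (by fun_prop : Continuous _).intervalIntegrable _ _, Finset.mul_sum]
  refine Finset.sum_congr rfl fun k _ => ?_
  rw [intervalIntegral.integral_finsetSum fun l _ =>
    (by fun_prop : Continuous _).intervalIntegrable _ _, Finset.mul_sum]
  refine Finset.sum_congr rfl fun l _ => ?_
  rw [intervalIntegral.integral_const_mul, integral_sin_int_mul hα, ← Real.sin_sub]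
  have : (((k : ℤ) - (l : ℤ) : ℤ) : ℝ) * x
      = ((k + 1 : ℕ) : ℝ) * x - ((l + 1 : ℕ) : ℝ) * x := by push_cast; ring
  rw [this]
  field_simp

/-- For `α = π` the coefficients are uncorrelated. -/
lemma crenelCorrelation_pi (k : ℕ) : crenelCorrelation Real.pi k = if k = 0 then 1 else 0 := by
  unfold crenelCorrelation
  split_ifs with h
  · rfl
  · rw [Real.sin_nat_mul_pi, zero_div]

/-- Parseval's identity for the two trigonometric sums. -/
lemma integral_period_cosSum_sq (A : ℕ → ℝ) (n : ℕ) (x : ℝ) :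
    ∫ u in (x - Real.pi)..(x + Real.pi), (cosSum A n u ^ 2 + sinSum A n u ^ 2)
      = 2 * Real.pi * ∑ k ∈ Finset.range n, A k ^ 2 := by
  have h := sum_sum_correlation_cos Real.pi_ne_zero A A n x
  have hpi := Real.pi_ne_zero
  have e : ∑ k ∈ Finset.range n, ∑ l ∈ Finset.range n,
      crenelCorrelation Real.pi ((k : ℤ) - (l : ℤ)).natAbs *
        (A k * A l * (Real.cos (((k + 1 : ℕ) : ℝ) * x) * Real.cos (((l + 1 : ℕ) : ℝ) * x)
          + Real.sin (((k + 1 : ℕ) : ℝ) * x) * Real.sin (((l + 1 : ℕ) : ℝ) * x)))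
      = ∑ k ∈ Finset.range n, A k ^ 2 := by
    refine Finset.sum_congr rfl fun k hk => ?_
    rw [Finset.sum_eq_single k]
    · have := Real.sin_sq_add_cos_sq (((k + 1 : ℕ) : ℝ) * x)
      simp only [sub_self, Int.natAbs_zero, crenelCorrelation_pi, if_true]
      linear_combination A k ^ 2 * this
    · intro l _ hl
      rw [crenelCorrelation_pi, if_neg, zero_mul]
      rw [Int.natAbs_eq_zero, sub_eq_zero]
      exact_mod_cast hl.symm
    · exact fun h => absurd hk h
  rw [e] at h
  simp only [sq] at h ⊢
  rw [h]
  field_simp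

lemma integral_period_kerSq (n : ℕ) (x : ℝ) :
    ∫ u in (x - Real.pi)..(x + Real.pi), kerSq n u = 2 * Real.pi * n := by
  unfold kerSq
  rw [integral_period_cosSum_sq]
  simp

lemma integral_period_kerDerivSq (n : ℕ) (x : ℝ) :
    ∫ u in (x - Real.pi)..(x + Real.pi), kerDerivSq n u
      = 2 * Real.pi * (n * (n + 1) * (2 * n + 1) / 6) := by
  unfold kerDerivSq
  rw [integral_period_cosSum_sq]
  congr 1
  induction n with
  | zero => simp
  | succ n ih =>
    rw [Finset.sum_range_succ, ih]
    simp only [succCoeff]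
    push_cast
    ring

/-! ### The density of the mean number of zeros -/

/-- The Kac–Rice density of the zeros of `f_n` for the correlation function
`crenelCorrelation α`. -/
noncomputable def zeroDensity (α : ℝ) (n : ℕ) (x : ℝ) : ℝ :=
  1 / Real.pi * (Real.sqrt ((∫ u in (x - α)..(x + α), kerDerivSq n u) *
      (∫ u in (x - α)..(x + α), kerSq n u) - (∫ u in (x - α)..(x + α), kerCross n u) ^ 2)
    / ∫ u in (x - α)..(x + α), kerSq n u)

lemma sub_one_div_le_integral_kerSq {α : ℝ} (hα : 0 < α) {n : ℕ} (hn : n ≠ 0) (x : ℝ) :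
    α - |Real.sin (n * α)| / n ≤ ∫ u in (x - α)..(x + α), kerSq n u := by
  have hn' : (0 : ℝ) < n := by positivity
  have h1 : ∫ u in (x - α)..(x + α), Real.sin (n * u / 2) ^ 2
      ≤ ∫ u in (x - α)..(x + α), kerSq n u :=
    intervalIntegral.integral_mono_on (by linarith)
      ((by fun_prop : Continuous fun u : ℝ => Real.sin (n * u / 2) ^ 2).intervalIntegrable _ _)
      ((continuous_kerSq n).intervalIntegrable _ _) fun u _ => sin_sq_le_kerSq n u
  refine le_trans ?_ h1
  have e : ∀ u : ℝ, Real.sin (n * u / 2) ^ 2 = 1 / 2 - 1 / 2 * Real.cos (n * u) := by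
    intro u
    rw [Real.sin_sq_eq_half_sub]
    ring_nf
  simp_rw [e]
  rw [intervalIntegral.integral_sub (continuous_const.intervalIntegrable _ _)
    ((by fun_prop : Continuous fun u : ℝ => 1 / 2 * Real.cos (n * u)).intervalIntegrable _ _),
    intervalIntegral.integral_const_mul,
    intervalIntegral.integral_comp_mul_left (fun u => Real.cos u) hn'.ne', integral_cos, mul_sub,
    mul_add, Real.sin_add, Real.sin_sub]
  simp only [intervalIntegral.integral_const, smul_eq_mul]
  have h2 : Real.cos (n * x) * Real.sin (n * α) ≤ |Real.sin (n * α)| := by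
    refine (le_abs_self _).trans ?_
    rw [abs_mul]
    exact mul_le_of_le_one_left (abs_nonneg _) (Real.abs_cos_le_one _)
  have h3 : Real.cos (n * x) * Real.sin (n * α) / n ≤ |Real.sin (n * α)| / n := by gcongr
  calc α - |Real.sin (n * α)| / n ≤ α - Real.cos (n * x) * Real.sin (n * α) / n := by linarith
    _ = _ := by field_simp; ring

lemma integral_kerSq_pos {α : ℝ} (hα : 0 < α) {n : ℕ} (hn : n ≠ 0) (x : ℝ) :
    0 < ∫ u in (x - α)..(x + α), kerSq n u := by
  have hn' : (0 : ℝ) < n := by positivity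
  refine lt_of_lt_of_le ?_ (sub_one_div_le_integral_kerSq hα hn x)
  have h : |Real.sin (n * α)| < |n * α| := Real.abs_sin_lt_abs (by positivity)
  rw [abs_of_pos (by positivity : (0 : ℝ) < n * α)] at h
  rw [sub_pos, div_lt_iff₀ hn']
  linarith

lemma countable_zeros_of_analytic {φ : ℝ → ℝ} (hφ : AnalyticOnNhd ℝ φ Set.univ)
    (hne : ∃ x, φ x ≠ 0) : {x | φ x = 0}.Countable := by
  rcases hφ.eqOn_zero_or_eventually_ne_zero_of_preconnected isPreconnected_univ with h | h
  · obtain ⟨x, hx⟩ := hne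
    exact absurd (h (Set.mem_univ x)) hx
  · have h' := (mem_codiscrete'.1 h).2
    have hset : {x | φ x ≠ 0}ᶜ = {x | φ x = 0} := by ext x; simp
    rw [hset] at h'
    exact (HereditarilyLindelofSpace.isLindelof _).countable_of_isDiscrete h'

lemma countable_zeros_cosSum_correlation (α : ℝ) {n : ℕ} (hn : n ≠ 0) :
    {x | cosSum (crenelCorrelation α) n x = 0}.Countable := by
  refine countable_zeros_of_analytic (fun x _ => ?_) ?_
  · unfold cosSum
    exact Finset.analyticAt_fun_sum _ fun k _ => by fun_prop
  · -- otherwise the first Fourier coefficient would vanish, but it is `ρ 0 = 1`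
    by_contra! h
    have hz : ∫ u in (0 - Real.pi)..(0 + Real.pi),
        cosSum (crenelCorrelation α) n u * Real.cos u = 0 := by simp [h]
    have hterm : ∀ k : ℕ, ∫ u in (0 - Real.pi)..(0 + Real.pi),
        crenelCorrelation α k * Real.cos (((k + 1 : ℕ) : ℝ) * u) * Real.cos u
          = if k = 0 then Real.pi else 0 := by
      intro k
      have e : ∀ u : ℝ, crenelCorrelation α k * Real.cos (((k + 1 : ℕ) : ℝ) * u) * Real.cos u
          = crenelCorrelation α k / 2 *
            (Real.cos (((k : ℤ) : ℝ) * u) + Real.cos (((k + 2 : ℤ) : ℝ) * u)) := by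
        intro u
        rw [show (((k + 2 : ℤ) : ℝ)) * u = ((k + 1 : ℕ) : ℝ) * u + u by push_cast; ring,
          show (((k : ℤ) : ℝ)) * u = ((k + 1 : ℕ) : ℝ) * u - u by push_cast; ring,
          Real.cos_add, Real.cos_sub]
        ring
      simp_rw [e]
      rw [intervalIntegral.integral_const_mul, intervalIntegral.integral_add
        ((by fun_prop : Continuous fun u : ℝ => Real.cos (((k : ℤ) : ℝ) * u)).intervalIntegrable
          _ _)
        ((by fun_prop : Continuous fun u : ℝ =>
          Real.cos (((k + 2 : ℤ) : ℝ) * u)).intervalIntegrable _ _),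
        integral_cos_int_mul Real.pi_ne_zero, integral_cos_int_mul Real.pi_ne_zero,
        crenelCorrelation_pi, crenelCorrelation_pi]
      have h2 : (k + 2 : ℤ).natAbs ≠ 0 := by omega
      rw [if_neg h2, Int.natAbs_natCast]
      split_ifs with hk
      · simp [hk, crenelCorrelation]
      · simp
    unfold cosSum at hz
    simp_rw [Finset.sum_mul] at hz
    rw [intervalIntegral.integral_finsetSum fun k _ =>
      (by fun_prop : Continuous _).intervalIntegrable _ _] at hz
    simp_rw [hterm] at hz
    rw [Finset.sum_ite_eq' (Finset.range n) 0] at hz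
    simp [Nat.pos_of_ne_zero hn, Real.pi_ne_zero] at hz

/-- The coefficients of `f_n` as one finite family. -/
def coeff {Ω : Type*} (a b : ℕ → Ω → ℝ) (n : ℕ) : Finset.range n ⊕ Finset.range n → Ω → ℝ :=
  Sum.elim (fun k => a k) (fun k => b k)

/-- The deterministic factors belonging to `coeff`. -/
def factor (n : ℕ) (p q : ℕ → ℝ) : Finset.range n ⊕ Finset.range n → ℝ :=
  Sum.elim (fun k => p k) (fun k => q k)

lemma sum_coeff_mul_factor {Ω : Type*} (a b : ℕ → Ω → ℝ) (n : ℕ) (p q : ℕ → ℝ) (ω : Ω) :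
    ∑ i, coeff a b n i ω * factor n p q i
      = ∑ k ∈ Finset.range n, (a k ω * p k + b k ω * q k) := by
  rw [Fintype.sum_sum_type, Finset.sum_add_distrib]
  simp only [coeff, factor, Sum.elim_inl, Sum.elim_inr]
  rw [Finset.sum_coe_sort (Finset.range n) fun k => a k ω * p k,
    Finset.sum_coe_sort (Finset.range n) fun k => b k ω * q k]

section Model

variable {Ω : Type*} [MeasurableSpace Ω] {P : Measure Ω} {ρ : ℕ → ℝ} {a b : ℕ → Ω → ℝ}

lemma IsStationaryGaussian.memLp (h : IsStationaryGaussian P ρ a) (k : ℕ) : MemLp (a k) 2 P :=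
  (h.gaussian.hasGaussianLaw_eval k).memLp_two

lemma IsStationaryGaussian.covariance (h : IsStationaryGaussian P ρ a) (k l : ℕ) :
    cov[a k, a l; P] = ρ ((k : ℤ) - (l : ℤ)).natAbs := by
  have := h.gaussian.isProbabilityMeasure
  rw [covariance_eq_sub (h.memLp k) (h.memLp l), h.centered k, zero_mul, sub_zero,
    ← h.correlation k l]
  rfl

lemma IsModel.covariance_left_right (h : IsModel P ρ a b) (k l : ℕ) : cov[a k, b l; P] = 0 :=
  (h.indep.comp (measurable_pi_apply k) (measurable_pi_apply l)).covariance_eq_zero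
    (h.left.memLp k) (h.right.memLp l)

lemma IsModel.measurable_coeff (h : IsModel P ρ a b) (n : ℕ)
    (i : Finset.range n ⊕ Finset.range n) : Measurable (coeff a b n i) := by
  rcases i with k | k
  · exact h.left.measurable k
  · exact h.right.measurable k

lemma IsModel.integral_coeff (h : IsModel P ρ a b) (n : ℕ)
    (i : Finset.range n ⊕ Finset.range n) : P[coeff a b n i] = 0 := by
  rcases i with k | k
  · exact h.left.centered k
  · exact h.right.centered k

lemma IsModel.hasGaussianLaw_coeff (h : IsModel P ρ a b) (n : ℕ) :
    HasGaussianLaw (fun ω i => coeff a b n i ω) P := by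
  have hind : IndepFun (fun ω => (Finset.range n).restrict (a · ω))
      (fun ω => (Finset.range n).restrict (b · ω)) P :=
    h.indep.comp (Finset.measurable_restrict _) (Finset.measurable_restrict _)
  have hG := (hind.hasGaussianLaw (h.left.gaussian.hasGaussianLaw _)
    (h.right.gaussian.hasGaussianLaw _)).map_fun
    (ContinuousLinearMap.pi (Sum.elim
      (fun k => (ContinuousLinearMap.proj (R := ℝ) (φ := fun _ : Finset.range n => ℝ) k).comp
        (ContinuousLinearMap.fst ℝ _ _))
      (fun k => (ContinuousLinearMap.proj (R := ℝ) (φ := fun _ : Finset.range n => ℝ) k).comp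
        (ContinuousLinearMap.snd ℝ _ _))))
  refine hG.congr (ae_of_all _ fun ω => ?_)
  funext i
  rcases i with k | k <;> rfl

lemma IsModel.covariance_sum (h : IsModel P ρ a b) (n : ℕ) (p q p' q' : ℕ → ℝ) :
    cov[fun ω => ∑ i, coeff a b n i ω * factor n p q i,
        fun ω => ∑ i, coeff a b n i ω * factor n p' q' i; P]
      = ∑ k ∈ Finset.range n, ∑ l ∈ Finset.range n,
        ρ ((k : ℤ) - (l : ℤ)).natAbs * (p k * p' l + q k * q' l) := by
  have := h.left.gaussian.isProbabilityMeasure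
  have hL : ∀ i, MemLp (coeff a b n i) 2 P := fun i => ((h.hasGaussianLaw_coeff n).eval i).memLp_two
  rw [covariance_fun_sum_fun_sum (fun i => (hL i).mul_const _) (fun i => (hL i).mul_const _)]
  simp only [covariance_mul_const_left, covariance_mul_const_right, Fintype.sum_sum_type,
    coeff, factor, Sum.elim_inl, Sum.elim_inr, h.left.covariance, h.right.covariance,
    h.covariance_left_right, covariance_comm (b _) (a _)]
  simp only [zero_mul, Finset.sum_const_zero, add_zero, zero_add]
  rw [← Finset.sum_add_distrib, ← Finset.sum_coe_sort (Finset.range n)]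
  refine Finset.sum_congr rfl fun k _ => ?_
  rw [← Finset.sum_add_distrib, ← Finset.sum_coe_sort (Finset.range n)]
  refine Finset.sum_congr rfl fun l _ => ?_
  ring

lemma measurable_zeroCount_trigPoly (ha : ∀ k, Measurable (a k)) (hb : ∀ k, Measurable (b k))
    (n : ℕ) (s t : ℝ) : Measurable fun ω => zeroCount (trigPoly a b n ω) s t := by
  refine measurable_zeroCount (fun ω => ?_) (fun x => ?_) s t
  · unfold trigPoly; fun_prop
  · unfold trigPoly; fun_prop

/-- The Kac–Rice formula for the random trigonometric polynomial, with the covariances expressed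
through the spectral measure. -/
theorem IsModel.lintegral_zeroCount {α : ℝ} (hα : 0 < α)
    (h : IsModel P (crenelCorrelation α) a b) {n : ℕ} (hn : n ≠ 0) (s t : ℝ) :
    ∫⁻ ω, zeroCount (trigPoly a b n ω) s t ∂P
      = ∫⁻ x in Set.Icc s t, ENNReal.ofReal (zeroDensity α n x) := by
  have hn' : (0 : ℝ) < n := by positivity
  set r : ℝ := 1 / Real.sqrt n with hr
  have hr0 : 0 < r := by positivity
  have hr2 : r * r = 1 / n := by
    rw [hr, div_mul_div_comm, Real.mul_self_sqrt hn'.le, one_mul]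
  set p : ℝ → ℕ → ℝ := fun x k => r * Real.cos (((k + 1 : ℕ) : ℝ) * x) with hp
  set q : ℝ → ℕ → ℝ := fun x k => r * Real.sin (((k + 1 : ℕ) : ℝ) * x) with hq
  set p' : ℝ → ℕ → ℝ := fun x k => -(r * (succCoeff k * Real.sin (((k + 1 : ℕ) : ℝ) * x))) with hp'
  set q' : ℝ → ℕ → ℝ := fun x k => r * (succCoeff k * Real.cos (((k + 1 : ℕ) : ℝ) * x)) with hq'
  have hpoly : ∀ ω, trigPoly a b n ω
      = fun x => ∑ i, coeff a b n i ω * factor n (p x) (q x) i := by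
    intro ω
    ext x
    rw [sum_coeff_mul_factor, trigPoly, Finset.mul_sum]
    refine Finset.sum_congr rfl fun k _ => ?_
    simp only [hp, hq]
    ring
  have cff : ∀ x, cov[fun ω => ∑ i, coeff a b n i ω * factor n (p x) (q x) i,
      fun ω => ∑ i, coeff a b n i ω * factor n (p x) (q x) i; P]
      = 1 / n * (1 / (2 * α)) * ∫ u in (x - α)..(x + α), kerSq n u := by
    intro x
    have := sum_sum_correlation_cos hα.ne' (fun _ => 1) (fun _ => 1) n x
    simp only [← sq] at this
    rw [h.covariance_sum, mul_assoc]
    unfold kerSq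
    rw [← this, Finset.mul_sum]
    refine Finset.sum_congr rfl fun k _ => ?_
    rw [Finset.mul_sum]
    refine Finset.sum_congr rfl fun l _ => ?_
    rw [← hr2]
    simp only [hp, hq]
    ring
  have cdd : ∀ x, cov[fun ω => ∑ i, coeff a b n i ω * factor n (p' x) (q' x) i,
      fun ω => ∑ i, coeff a b n i ω * factor n (p' x) (q' x) i; P]
      = 1 / n * (1 / (2 * α)) * ∫ u in (x - α)..(x + α), kerDerivSq n u := by
    intro x
    have := sum_sum_correlation_cos hα.ne' succCoeff succCoeff n x
    simp only [← sq] at this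
    rw [h.covariance_sum, mul_assoc]
    unfold kerDerivSq
    rw [← this, Finset.mul_sum]
    refine Finset.sum_congr rfl fun k _ => ?_
    rw [Finset.mul_sum]
    refine Finset.sum_congr rfl fun l _ => ?_
    rw [← hr2]
    simp only [hp', hq']
    ring
  have cfd : ∀ x, cov[fun ω => ∑ i, coeff a b n i ω * factor n (p x) (q x) i,
      fun ω => ∑ i, coeff a b n i ω * factor n (p' x) (q' x) i; P]
      = 1 / n * (1 / (2 * α)) * ∫ u in (x - α)..(x + α), kerCross n u := by
    intro x
    have := sum_sum_correlation_sin hα.ne' (fun _ => 1) succCoeff n x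
    rw [h.covariance_sum, mul_assoc]
    unfold kerCross
    rw [← this, Finset.mul_sum]
    refine Finset.sum_congr rfl fun k _ => ?_
    rw [Finset.mul_sum]
    refine Finset.sum_congr rfl fun l _ => ?_
    rw [← hr2]
    simp only [hp, hq, hp', hq']
    ring
  have h0n : 0 ∈ Finset.range n := Finset.mem_range.2 (Nat.pos_of_ne_zero hn)
  have hcov0 : cov[coeff a b n (Sum.inl ⟨0, h0n⟩), coeff a b n (Sum.inl ⟨0, h0n⟩); P] = 1 := by
    simp [coeff, h.left.covariance, crenelCorrelation]
  have hφ : ∀ x, ∑ i, cov[coeff a b n i, coeff a b n (Sum.inl ⟨0, h0n⟩); P] *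
      factor n (p x) (q x) i = r * cosSum (crenelCorrelation α) n x := by
    intro x
    rw [Fintype.sum_sum_type]
    simp only [coeff, factor, Sum.elim_inl, Sum.elim_inr, h.left.covariance,
      covariance_comm (b _) (a _), h.covariance_left_right, zero_mul, Finset.sum_const_zero,
      add_zero, Nat.cast_zero, sub_zero, Int.natAbs_natCast]
    rw [Finset.sum_coe_sort (Finset.range n) fun k => crenelCorrelation α k * p x k, cosSum,
      Finset.mul_sum]
    refine Finset.sum_congr rfl fun k _ => ?_
    simp only [hp]
    ring
  simp_rw [hpoly]
  rw [lintegral_zeroCount_gaussian (e := fun i x => factor n (p x) (q x) i)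
    (e' := fun i x => factor n (p' x) (q' x) i) (h.measurable_coeff n)
    (h.hasGaussianLaw_coeff n) (h.integral_coeff n) ?_ ?_ hcov0 ?_ ?_ s t]
  · refine lintegral_congr fun x => ?_
    rw [cff, cdd, cfd, zeroDensity]
    congr 2
    set K := 1 / (n : ℝ) * (1 / (2 * α)) with hK
    have hK0 : 0 < K := by positivity
    have e : ∀ A B C : ℝ, K * A * (K * B) - (K * C) ^ 2 = K ^ 2 * (A * B - C ^ 2) := by
      intro A B C; ring
    rw [e, Real.sqrt_mul (sq_nonneg K), Real.sqrt_sq hK0.le, mul_div_mul_left _ _ hK0.ne']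
  · rintro (k | k) x
    · simp only [factor, Sum.elim_inl, hp, hp']
      refine (((hasDerivAt_id x).const_mul (((k + 1 : ℕ) : ℝ))).cos.const_mul r).congr_deriv ?_
      simp only [succCoeff, id]
      ring
    · simp only [factor, Sum.elim_inr, hq, hq']
      refine (((hasDerivAt_id x).const_mul (((k + 1 : ℕ) : ℝ))).sin.const_mul r).congr_deriv ?_
      simp only [succCoeff, id]
      ring
  · rintro (k | k)
    · simp only [factor, Sum.elim_inl, hp']; fun_prop
    · simp only [factor, Sum.elim_inr, hq']; fun_prop
  · simp_rw [hφ, mul_eq_zero, hr0.ne', false_or]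
    exact countable_zeros_cosSum_correlation α hn
  · intro x
    rw [cff]
    have := integral_kerSq_pos hα hn x
    positivity

end Model

/-! ### Asymptotics of the density -/

lemma continuous_integral_window {g : ℝ → ℝ} (hg : Continuous g) (α : ℝ) :
    Continuous fun x => ∫ u in (x - α)..(x + α), g u := by
  have hi : ∀ p q : ℝ, IntervalIntegrable g volume p q := fun p q => hg.intervalIntegrable p q
  have h := intervalIntegral.continuous_primitive hi 0
  have e : (fun x => ∫ u in (x - α)..(x + α), g u)
      = fun x => (∫ u in (0 : ℝ)..(x + α), g u) - ∫ u in (0 : ℝ)..(x - α), g u := by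
    ext x
    rw [intervalIntegral.integral_interval_sub_left (hi _ _) (hi _ _)]
  rw [e]
  exact (h.comp (continuous_id.add continuous_const)).sub
    (h.comp (continuous_id.sub continuous_const))

lemma measurable_zeroDensity (α : ℝ) (n : ℕ) : Measurable (zeroDensity α n) := by
  have h1 := (continuous_integral_window (continuous_kerSq n) α).measurable
  have h2 := (continuous_integral_window (continuous_kerDerivSq n) α).measurable
  have h3 := (continuous_integral_window (continuous_kerCross n) α).measurable
  unfold zeroDensity
  exact measurable_const.mul ((((h2.mul h1).sub (h3.pow_const 2)).sqrt).div h1)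

lemma zeroDensity_two_pi_sub (α : ℝ) (n : ℕ) (x : ℝ) :
    zeroDensity α n (2 * Real.pi - x) = zeroDensity α n x := by
  have e : ∀ g : ℝ → ℝ, ∫ u in (2 * Real.pi - x - α)..(2 * Real.pi - x + α), g u
      = ∫ u in (x - α)..(x + α), g (2 * Real.pi - u) := by
    intro g
    rw [intervalIntegral.integral_comp_sub_left]
    congr 1 <;> ring
  have h1 : ∀ u, kerSq n (2 * Real.pi - u) = kerSq n u := fun u => by
    simp [kerSq, cosSum_two_pi_sub, sinSum_two_pi_sub]
  have h2 : ∀ u, kerDerivSq n (2 * Real.pi - u) = kerDerivSq n u := fun u => by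
    simp [kerDerivSq, cosSum_two_pi_sub, sinSum_two_pi_sub]
  have h3 : ∀ u, kerCross n (2 * Real.pi - u) = -kerCross n u := fun u => by
    simp [kerCross, cosSum_two_pi_sub, sinSum_two_pi_sub]; ring
  unfold zeroDensity
  rw [e, e, e]
  simp only [h1, h2, h3, intervalIntegral.integral_neg, neg_sq]

/-- The density with its natural powers of `n` divided out: scaling the three integrals by
`c² / n²`, `c` and `c / n` scales the density by `1 / n`. -/
lemma zeroDensity_div (α : ℝ) (n : ℕ) (x : ℝ) {c : ℝ} (hc : 0 < c) (hn : n ≠ 0) :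
    zeroDensity α n x / n = 1 / Real.pi * (Real.sqrt
      ((c / n ^ 2 * ∫ u in (x - α)..(x + α), kerDerivSq n u) *
        (c * ∫ u in (x - α)..(x + α), kerSq n u)
        - (c / n * ∫ u in (x - α)..(x + α), kerCross n u) ^ 2)
      / (c * ∫ u in (x - α)..(x + α), kerSq n u)) := by
  have hn' : (0 : ℝ) < n := by positivity
  unfold zeroDensity
  set T := ∫ u in (x - α)..(x + α), kerDerivSq n u
  set S := ∫ u in (x - α)..(x + α), kerSq n u
  set X := ∫ u in (x - α)..(x + α), kerCross n u
  have e : c / n ^ 2 * T * (c * S) - (c / n * X) ^ 2 = (c / n) ^ 2 * (T * S - X ^ 2) := by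
    field_simp
  rw [e, Real.sqrt_mul (sq_nonneg _), Real.sqrt_sq (by positivity)]
  field_simp

lemma zeroDensity_div_le {α : ℝ} {n : ℕ} {x M : ℝ} (hn : n ≠ 0) (hM : 0 ≤ M)
    (hS : 0 < ∫ u in (x - α)..(x + α), kerSq n u)
    (hT : ∫ u in (x - α)..(x + α), kerDerivSq n u
      ≤ M * n ^ 2 * ∫ u in (x - α)..(x + α), kerSq n u) :
    zeroDensity α n x / n ≤ Real.sqrt M / Real.pi := by
  have hn' : (0 : ℝ) < n := by positivity
  have hpi := Real.pi_pos
  unfold zeroDensity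
  set T := ∫ u in (x - α)..(x + α), kerDerivSq n u
  set S := ∫ u in (x - α)..(x + α), kerSq n u
  set X := ∫ u in (x - α)..(x + α), kerCross n u
  have h1 : Real.sqrt (T * S - X ^ 2) ≤ Real.sqrt M * (n * S) := by
    rw [Real.sqrt_le_left (by positivity), mul_pow, Real.sq_sqrt hM]
    nlinarith [sq_nonneg X, mul_le_mul_of_nonneg_right hT hS.le]
  have h2 : Real.sqrt (T * S - X ^ 2) / S ≤ Real.sqrt M * n := by
    rw [div_le_iff₀ hS]
    exact h1.trans (le_of_eq (by ring))
  rw [div_le_div_iff₀ hn' hpi]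
  calc 1 / Real.pi * (Real.sqrt (T * S - X ^ 2) / S) * Real.pi
      = Real.sqrt (T * S - X ^ 2) / S := by field_simp
    _ ≤ _ := h2

lemma div_pi_le_sin_half {d u : ℝ} (hd : 0 ≤ d) (h1 : d ≤ u) (h2 : u ≤ 2 * Real.pi - d) :
    d / Real.pi ≤ Real.sin (u / 2) := by
  have hpi := Real.pi_pos
  rcases le_total u Real.pi with h | h
  · have := Real.mul_le_sin (x := u / 2) (by linarith) (by linarith)
    refine le_trans ?_ this
    rw [div_le_iff₀ hpi]
    field_simp
    linarith
  · have := Real.mul_le_sin (x := Real.pi - u / 2) (by linarith) (by linarith)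
    rw [Real.sin_pi_sub] at this
    refine le_trans ?_ this
    rw [div_le_iff₀ hpi]
    field_simp
    linarith

lemma one_div_sin_sq_le {d u : ℝ} (hd : 0 < d) (h : d / Real.pi ≤ |Real.sin (u / 2)|) :
    1 / Real.sin (u / 2) ^ 2 ≤ (Real.pi / d) ^ 2 := by
  have hpi := Real.pi_pos
  have h0 : 0 < d / Real.pi := by positivity
  rw [← sq_abs (Real.sin _), ← one_div_pow]
  have : 1 / |Real.sin (u / 2)| ≤ Real.pi / d := by
    rw [← one_div_div d Real.pi]
    exact one_div_le_one_div_of_le h0 h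
  gcongr

lemma abs_integral_window_sub_le {g : ℝ → ℝ} (hg : Continuous g) {α x d M : ℝ} (hα : α ≤ Real.pi)
    (hx0 : 0 ≤ x) (hd : 0 < d) (hdx : d = α - x)
    (hM : ∀ u, d / Real.pi ≤ |Real.sin (u / 2)| → |g u| ≤ M) :
    |(∫ u in (x - α)..(x + α), g u) - ∫ u in (x - Real.pi)..(x + Real.pi), g u|
      ≤ 2 * Real.pi * M := by
  have hpi := Real.pi_pos
  have hi : ∀ p q : ℝ, IntervalIntegrable g volume p q := fun p q => hg.intervalIntegrable p q
  have e : (∫ u in (x - α)..(x + α), g u) - ∫ u in (x - Real.pi)..(x + Real.pi), g u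
      = -((∫ u in (x - Real.pi)..(x - α), g u) + ∫ u in (x + α)..(x + Real.pi), g u) := by
    rw [← intervalIntegral.integral_add_adjacent_intervals (hi (x - Real.pi) (x - α))
        (hi (x - α) (x + Real.pi)),
      ← intervalIntegral.integral_add_adjacent_intervals (hi (x - α) (x + α))
        (hi (x + α) (x + Real.pi))]
    ring
  have hM0 : 0 ≤ M := by
    refine (abs_nonneg _).trans (hM (2 * (Real.pi / 2)) ?_)
    rw [mul_div_cancel_left₀ _ two_ne_zero, Real.sin_pi_div_two, abs_one, div_le_one hpi]
    linarith
  have h1 : ‖∫ u in (x - Real.pi)..(x - α), g u‖ ≤ M * |x - α - (x - Real.pi)| := by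
    refine intervalIntegral.norm_integral_le_of_norm_le_const fun u hu => hM u ?_
    rw [Set.uIoc_of_le (by linarith)] at hu
    have := div_pi_le_sin_half (u := -u) hd.le (by linarith [hu.2]) (by linarith [hu.1])
    rw [neg_div, Real.sin_neg] at this
    exact this.trans (neg_le_abs _)
  have h2 : ‖∫ u in (x + α)..(x + Real.pi), g u‖ ≤ M * |x + Real.pi - (x + α)| := by
    refine intervalIntegral.norm_integral_le_of_norm_le_const fun u hu => hM u ?_
    rw [Set.uIoc_of_le (by linarith)] at hu
    have := div_pi_le_sin_half (u := u) hd.le (by linarith [hu.1]) (by linarith [hu.2])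
    exact this.trans (le_abs_self _)
  rw [Real.norm_eq_abs] at h1 h2
  have a1 : |x - α - (x - Real.pi)| = Real.pi - α := by
    rw [show x - α - (x - Real.pi) = Real.pi - α by ring, abs_of_nonneg (by linarith)]
  have a2 : |x + Real.pi - (x + α)| = Real.pi - α := by
    rw [show x + Real.pi - (x + α) = Real.pi - α by ring, abs_of_nonneg (by linarith)]
  rw [a1] at h1
  rw [a2] at h2
  rw [e, abs_neg]
  refine (abs_add_le _ _).trans ?_
  nlinarith

lemma abs_integral_kerCross_le {n : ℕ} {α x d : ℝ} (hd : 0 < d)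
    (h1 : d / Real.pi ≤ |Real.sin ((x - α) / 2)|) (h2 : d / Real.pi ≤ |Real.sin ((x + α) / 2)|) :
    |∫ u in (x - α)..(x + α), kerCross n u| ≤ (Real.pi / d) ^ 2 := by
  have h0 : 0 < d / Real.pi := by have := Real.pi_pos; positivity
  have b1 := (kerSq_le n (abs_pos.1 (h0.trans_le h1))).trans (one_div_sin_sq_le hd h1)
  have b2 := (kerSq_le n (abs_pos.1 (h0.trans_le h2))).trans (one_div_sin_sq_le hd h2)
  have c1 := kerSq_nonneg n (x - α)
  have c2 := kerSq_nonneg n (x + α)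
  rw [integral_kerCross, abs_le]
  constructor <;> linarith

lemma tendsto_const_div_nat (C : ℝ) : Tendsto (fun n : ℕ => C / (n : ℝ)) atTop (𝓝 0) :=
  tendsto_const_nhds.div_atTop tendsto_natCast_atTop_atTop

/-- Inside the support of the spectral density the window contains the peak of the kernels. -/
lemma tendsto_zeroDensity_inside {α x : ℝ} (hα : α ≤ Real.pi) (hx0 : 0 ≤ x) (hx : x < α) :
    Tendsto (fun n : ℕ => zeroDensity α n x / n) atTop (𝓝 (1 / (Real.pi * Real.sqrt 3))) := by
  have hpi := Real.pi_pos
  set d := α - x with hd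
  have hd0 : 0 < d := sub_pos.2 hx
  have hdpi : 0 < d / Real.pi := by positivity
  set m := (Real.pi / d) ^ 2 with hm
  have hS : Tendsto (fun n : ℕ => 1 / (n : ℝ) * ∫ u in (x - α)..(x + α), kerSq n u) atTop
      (𝓝 (2 * Real.pi)) := by
    rw [tendsto_iff_norm_sub_tendsto_zero]
    refine squeeze_zero' (Eventually.of_forall fun _ => norm_nonneg _) ?_
      (tendsto_const_div_nat (2 * Real.pi * m))
    filter_upwards [eventually_ne_atTop 0] with n hn
    have hn' : (0 : ℝ) < n := by positivity
    have h := abs_integral_window_sub_le (continuous_kerSq n) hα hx0 hd0 hd (M := m) fun u hu => by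
      rw [abs_of_nonneg (kerSq_nonneg n u)]
      exact (kerSq_le n (abs_pos.1 (hdpi.trans_le hu))).trans (one_div_sin_sq_le hd0 hu)
    rw [integral_period_kerSq] at h
    rw [Real.norm_eq_abs, show 1 / (n : ℝ) * (∫ u in (x - α)..(x + α), kerSq n u) - 2 * Real.pi
      = ((∫ u in (x - α)..(x + α), kerSq n u) - 2 * Real.pi * n) / n by field_simp, abs_div,
      abs_of_pos hn']
    gcongr
  have hT : Tendsto (fun n : ℕ => 1 / (n : ℝ) / (n : ℝ) ^ 2 *
      ∫ u in (x - α)..(x + α), kerDerivSq n u) atTop (𝓝 (2 * Real.pi / 3)) := by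
    have hmain : Tendsto (fun n : ℕ => 2 * Real.pi * ((1 + 1 / (n : ℝ)) * (2 + 1 / (n : ℝ)) / 6))
        atTop (𝓝 (2 * Real.pi / 3)) := by
      have h1 := tendsto_const_div_nat 1
      have := ((((h1.const_add 1).mul (h1.const_add 2)).div_const 6).const_mul (2 * Real.pi))
      convert this using 2
      ring
    have hdiff : Tendsto (fun n : ℕ => 1 / (n : ℝ) / (n : ℝ) ^ 2 *
        (∫ u in (x - α)..(x + α), kerDerivSq n u)
        - 2 * Real.pi * ((1 + 1 / (n : ℝ)) * (2 + 1 / (n : ℝ)) / 6)) atTop (𝓝 0) := by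
      rw [tendsto_zero_iff_norm_tendsto_zero]
      refine squeeze_zero' (Eventually.of_forall fun _ => norm_nonneg _) ?_
        (tendsto_const_div_nat (2 * Real.pi * (2 * m)))
      filter_upwards [eventually_ne_atTop 0] with n hn
      have hn' : (0 : ℝ) < n := by positivity
      have h := abs_integral_window_sub_le (continuous_kerDerivSq n) hα hx0 hd0 hd
          (M := 2 * n ^ 2 * m) fun u hu => by
        rw [abs_of_nonneg (kerDerivSq_nonneg n u)]
        refine (kerDerivSq_le n (abs_pos.1 (hdpi.trans_le hu))).trans ?_
        have := one_div_sin_sq_le hd0 hu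
        gcongr
      rw [integral_period_kerDerivSq] at h
      rw [Real.norm_eq_abs, show 1 / (n : ℝ) / (n : ℝ) ^ 2 *
          (∫ u in (x - α)..(x + α), kerDerivSq n u)
          - 2 * Real.pi * ((1 + 1 / (n : ℝ)) * (2 + 1 / (n : ℝ)) / 6)
        = ((∫ u in (x - α)..(x + α), kerDerivSq n u)
          - 2 * Real.pi * (n * (n + 1) * (2 * n + 1) / 6)) / n ^ 3 by field_simp, abs_div,
        abs_of_pos (by positivity : (0 : ℝ) < (n : ℝ) ^ 3), div_le_div_iff₀ (by positivity) hn']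
      calc _ ≤ 2 * Real.pi * (2 * n ^ 2 * m) * n := by gcongr
        _ = _ := by ring
    simpa using hdiff.add hmain
  have hX : Tendsto (fun n : ℕ => 1 / (n : ℝ) / (n : ℝ) *
      ∫ u in (x - α)..(x + α), kerCross n u) atTop (𝓝 0) := by
    rw [tendsto_zero_iff_norm_tendsto_zero]
    refine squeeze_zero' (Eventually.of_forall fun _ => norm_nonneg _) ?_ (tendsto_const_div_nat m)
    filter_upwards [eventually_ne_atTop 0] with n hn
    have hn1 : (1 : ℝ) ≤ n := by exact_mod_cast Nat.one_le_iff_ne_zero.2 hn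
    have hb1 : d / Real.pi ≤ |Real.sin ((x - α) / 2)| := by
      have := div_pi_le_sin_half (d := d) (u := -(x - α)) hd0.le (by linarith) (by linarith)
      rw [neg_div, Real.sin_neg] at this
      exact this.trans (neg_le_abs _)
    have hb2 : d / Real.pi ≤ |Real.sin ((x + α) / 2)| :=
      (div_pi_le_sin_half (d := d) hd0.le (by linarith) (by linarith)).trans (le_abs_self _)
    have h := abs_integral_kerCross_le (n := n) hd0 hb1 hb2
    rw [Real.norm_eq_abs, abs_mul, abs_of_pos (by positivity)]
    calc 1 / (n : ℝ) / n * _ ≤ 1 / (n : ℝ) / 1 * m := by gcongr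
      _ = m / n := by ring
  have hlim := (((hT.mul hS).sub (hX.pow 2)).sqrt.div hS (by positivity)).const_mul (1 / Real.pi)
  have hval : 1 / Real.pi * (Real.sqrt (2 * Real.pi / 3 * (2 * Real.pi) - 0 ^ 2) / (2 * Real.pi))
      = 1 / (Real.pi * Real.sqrt 3) := by
    rw [show 2 * Real.pi / 3 * (2 * Real.pi) - 0 ^ 2 = (2 * Real.pi) ^ 2 / 3 by ring,
      Real.sqrt_div (by positivity), Real.sqrt_sq (by positivity)]
    field_simp
  rw [hval] at hlim
  refine hlim.congr' ?_
  filter_upwards [eventually_ne_atTop 0] with n hn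
  have hn' : (0 : ℝ) < n := by positivity
  exact (zeroDensity_div α n x (c := 1 / n) (by positivity) hn).symm

lemma tendsto_integral_cos_mul {h : ℝ → ℝ} {p q : ℝ} (hpq : p ≤ q)
    (hint : IntervalIntegrable h volume p q) :
    Tendsto (fun n : ℕ => ∫ u in p..q, Real.cos (n * u) * h u) atTop (𝓝 0) := by
  have hpi := Real.pi_pos
  set f : ℝ → ℂ := (Set.Ioc p q).indicator fun u => (h u : ℂ) with hf
  have hfint : Integrable f := by
    rw [hf, integrable_indicator_iff measurableSet_Ioc]
    exact ((intervalIntegrable_iff_integrableOn_Ioc_of_le hpq).1 hint).ofReal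
  have hw : Tendsto (fun n : ℕ => (n : ℝ) / (2 * Real.pi)) atTop (cocompact ℝ) :=
    (tendsto_natCast_atTop_atTop.atTop_div_const (by positivity)).mono_right atTop_le_cocompact
  have h1 := (Real.tendsto_integral_exp_smul_cocompact f).comp hw
  have h2 := (Complex.continuous_re.tendsto 0).comp h1
  refine h2.congr fun n => ?_
  simp only [Function.comp_apply]
  rw [intervalIntegral.integral_of_le hpq, ← integral_indicator measurableSet_Ioc]
  have hint2 : Integrable fun v : ℝ =>
      Real.fourierChar (-(v * ((n : ℝ) / (2 * Real.pi)))) • f v := by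
    refine (integrable_norm_iff ?_).1 ?_
    · have hc : Continuous fun v : ℝ =>
          ((Real.fourierChar (-(v * ((n : ℝ) / (2 * Real.pi)))) : Circle) : ℂ) := by fun_prop
      exact hc.aestronglyMeasurable.mul hfint.aestronglyMeasurable
    · simpa using hfint.norm
  have h3 := Complex.reCLM.integral_comp_comm hint2
  simp only [Complex.reCLM_apply] at h3
  rw [← h3]
  refine integral_congr_ae (ae_of_all _ fun v => ?_)
  simp only [hf, Set.indicator]
  split_ifs with hv
  · rw [Circle.smul_def, Real.fourierChar_apply, smul_eq_mul, Complex.re_mul_ofReal]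
    have e : ((2 * Real.pi * -(v * ((n : ℝ) / (2 * Real.pi))) : ℝ) : ℂ)
        = ((-(n * v) : ℝ) : ℂ) := by
      congr 1
      field_simp
    rw [e, Complex.exp_ofReal_mul_I_re, Real.cos_neg]
  · simp

/-- Outside the support of the spectral density the window stays away from the peak; there
`kerSq` oscillates around `1 / (2 sin² (u / 2))`, and `kerDerivSq` is equivalent to
`n² / (4 sin² (u / 2))`. -/
lemma tendsto_zeroDensity_outside {α x : ℝ} (hα0 : 0 < α) (hx : α < x) (hxpi : x ≤ Real.pi) :
    Tendsto (fun n : ℕ => zeroDensity α n x / n) atTop (𝓝 (1 / (Real.pi * Real.sqrt 2))) := by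
  have hpi := Real.pi_pos
  set d := x - α with hd
  have hd0 : 0 < d := sub_pos.2 hx
  have hdpi : 0 < d / Real.pi := by positivity
  have hsin : ∀ u ∈ Set.Icc (x - α) (x + α), d / Real.pi ≤ Real.sin (u / 2) := fun u hu =>
    div_pi_le_sin_half hd0.le hu.1 (by linarith [hu.2])
  have hsin0 : ∀ u ∈ Set.Icc (x - α) (x + α), Real.sin (u / 2) ≠ 0 := fun u hu =>
    (hdpi.trans_le (hsin u hu)).ne'
  set h : ℝ → ℝ := fun u => 1 / Real.sin (u / 2) ^ 2 with hh
  have hle : x - α ≤ x + α := by linarith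
  have hcont : ContinuousOn h (Set.Icc (x - α) (x + α)) := by
    refine continuousOn_const.div (by fun_prop) fun u hu => pow_ne_zero 2 (hsin0 u hu)
  have hint : IntervalIntegrable h volume (x - α) (x + α) :=
    hcont.intervalIntegrable_of_Icc hle
  set A := ∫ u in (x - α)..(x + α), h u with hA
  have hA0 : 0 < A := by
    refine intervalIntegral.intervalIntegral_pos_of_pos_on hint (fun u hu => ?_) (by linarith)
    have := hsin0 u ⟨hu.1.le, hu.2.le⟩
    simp only [hh]
    positivity
  have hS : Tendsto (fun n : ℕ => 1 * ∫ u in (x - α)..(x + α), kerSq n u) atTop (𝓝 (A / 2)) := by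
    have hRL := (tendsto_integral_cos_mul hle hint).const_mul (1 / 2)
    have := hRL.const_sub (A / 2)
    rw [mul_zero, sub_zero] at this
    refine this.congr fun n => ?_
    have hci : IntervalIntegrable (fun u => Real.cos (n * u) * h u) volume (x - α) (x + α) :=
      hint.continuousOn_mul (by fun_prop)
    rw [one_mul, hA, ← intervalIntegral.integral_const_mul, ← intervalIntegral.integral_div,
      ← intervalIntegral.integral_sub (hint.div_const 2) (hci.const_mul _)]
    refine intervalIntegral.integral_congr fun u hu => ?_
    rw [Set.uIcc_of_le hle] at hu
    have hs := hsin0 u hu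
    have hk := kerSq_mul_sin_sq n u
    have e2 : Real.sin (n * u / 2) ^ 2 = (1 - Real.cos (n * u)) / 2 := by
      rw [Real.sin_sq_eq_half_sub]
      ring_nf
    rw [e2] at hk
    simp only [hh]
    rw [eq_div_of_mul_eq (pow_ne_zero 2 hs) hk]
    ring
  have hT : Tendsto (fun n : ℕ => 1 / (n : ℝ) ^ 2 *
      ∫ u in (x - α)..(x + α), kerDerivSq n u) atTop (𝓝 (A / 4)) := by
    set m := Real.pi / d with hm
    have hm0 : 0 < m := by positivity
    have hdiff : Tendsto (fun n : ℕ => 1 / (n : ℝ) ^ 2 *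
        (∫ u in (x - α)..(x + α), kerDerivSq n u) - A / 4) atTop (𝓝 0) := by
      rw [tendsto_zero_iff_norm_tendsto_zero]
      refine squeeze_zero' (Eventually.of_forall fun _ => norm_nonneg _) ?_
        (tendsto_const_div_nat ((2 * m ^ 2 + 4 * m) * m ^ 2 / 4 * (2 * α)))
      filter_upwards [eventually_ne_atTop 0] with n hn
      have hn' : (0 : ℝ) < n := by positivity
      have hn1 : (1 : ℝ) ≤ n := by exact_mod_cast Nat.one_le_iff_ne_zero.2 hn
      rw [hA, ← intervalIntegral.integral_const_mul, ← intervalIntegral.integral_div,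
        ← intervalIntegral.integral_sub
          ((by fun_prop : Continuous fun u => 1 / (n : ℝ) ^ 2 * kerDerivSq n u).intervalIntegrable
            _ _) (hint.div_const 4)]
      have hbound : ∀ u ∈ Set.uIoc (x - α) (x + α),
          ‖1 / (n : ℝ) ^ 2 * kerDerivSq n u - h u / 4‖
            ≤ (2 * m ^ 2 + 4 * m) * m ^ 2 / 4 / n := by
        intro u hu
        rw [Set.uIoc_of_le hle] at hu
        have hu' : u ∈ Set.Icc (x - α) (x + α) := ⟨hu.1.le, hu.2⟩
        have hs := hsin u hu'
        have hspos := hdpi.trans_le hs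
        have hb := abs_four_sin_sq_mul_kerDerivSq_sub n (hsin0 u hu')
        rw [abs_of_pos hspos] at hb
        have hinv : 1 / Real.sin (u / 2) ≤ m := by
          rw [hm, ← one_div_div d Real.pi]
          exact one_div_le_one_div_of_le hdpi hs
        set σ := Real.sin (u / 2) with hσ
        have hinv0 : 0 < 1 / σ := by positivity
        have hb2 : |4 * σ ^ 2 * kerDerivSq n u - n ^ 2| ≤ (2 * m ^ 2 + 4 * m) * n := by
          refine hb.trans ?_
          calc 2 * (1 / σ) ^ 2 + 4 * n * (1 / σ) ≤ 2 * m ^ 2 * 1 + 4 * n * m := by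
                rw [mul_one]; gcongr
            _ ≤ 2 * m ^ 2 * n + 4 * n * m := by gcongr
            _ = _ := by ring
        have e : 1 / (n : ℝ) ^ 2 * kerDerivSq n u - h u / 4
            = (4 * σ ^ 2 * kerDerivSq n u - n ^ 2) * ((1 / σ) ^ 2 / (4 * n ^ 2)) := by
          simp only [hh, ← hσ]
          field_simp
        rw [e, Real.norm_eq_abs, abs_mul,
          abs_of_pos (by positivity : 0 < (1 / σ) ^ 2 / (4 * (n : ℝ) ^ 2))]
        calc _ ≤ (2 * m ^ 2 + 4 * m) * n * (m ^ 2 / (4 * n ^ 2)) := by gcongr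
          _ = _ := by field_simp
      refine (intervalIntegral.norm_integral_le_of_norm_le_const hbound).trans (le_of_eq ?_)
      rw [show x + α - (x - α) = 2 * α by ring, abs_of_pos (by positivity)]
      ring
    simpa using hdiff.add_const (A / 4)
  have hX : Tendsto (fun n : ℕ => 1 / (n : ℝ) *
      ∫ u in (x - α)..(x + α), kerCross n u) atTop (𝓝 0) := by
    rw [tendsto_zero_iff_norm_tendsto_zero]
    refine squeeze_zero (fun _ => norm_nonneg _) (fun n => ?_)
      (tendsto_const_div_nat ((Real.pi / d) ^ 2))
    have h := abs_integral_kerCross_le (n := n) (α := α) (x := x) hd0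
      ((hsin _ (Set.left_mem_Icc.2 hle)).trans (le_abs_self _))
      ((hsin _ (Set.right_mem_Icc.2 hle)).trans (le_abs_self _))
    rw [Real.norm_eq_abs, abs_mul, abs_of_nonneg (by positivity), one_div_mul_eq_div]
    gcongr
  have hlim := (((hT.mul hS).sub (hX.pow 2)).sqrt.div hS (by positivity)).const_mul (1 / Real.pi)
  have hval : 1 / Real.pi * (Real.sqrt (A / 4 * (A / 2) - 0 ^ 2) / (A / 2))
      = 1 / (Real.pi * Real.sqrt 2) := by
    rw [show A / 4 * (A / 2) - 0 ^ 2 = (A / 2) ^ 2 / 2 by ring,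
      Real.sqrt_div (by positivity), Real.sqrt_sq (by positivity)]
    field_simp
  rw [hval] at hlim
  refine hlim.congr' ?_
  filter_upwards [eventually_ne_atTop 0] with n hn
  exact (zeroDensity_div α n x one_pos hn).symm

lemma zeroDensity_div_le_inside {α x : ℝ} (hα : α ≤ Real.pi) (hx0 : 0 ≤ x)
    (hx : x < α) {n : ℕ} (hn : n ≠ 0) (hnα : 1 / (n : ℝ) ≤ α) :
    zeroDensity α n x / n ≤ Real.sqrt (8 * Real.pi) / Real.pi := by
  have hpi := Real.pi_pos
  have hn' : (0 : ℝ) < n := by positivity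
  have hn1 : (1 : ℝ) ≤ n := by exact_mod_cast Nat.one_le_iff_ne_zero.2 hn
  have hS : (n : ℝ) / 4 ≤ ∫ u in (x - α)..(x + α), kerSq n u := by
    have h1 : ∫ u in (0 : ℝ)..(1 / n), (n : ℝ) ^ 2 / 4 ≤ ∫ u in (0 : ℝ)..(1 / n), kerSq n u := by
      refine intervalIntegral.integral_mono_on (by positivity)
        (continuous_const.intervalIntegrable _ _)
        ((continuous_kerSq n).intervalIntegrable _ _) fun u hu => kerSq_ge_of_mem_Icc hu.1 ?_
      have := hu.2
      rw [le_div_iff₀ hn'] at this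
      linarith
    have h2 : ∫ u in (0 : ℝ)..(1 / n), kerSq n u ≤ ∫ u in (x - α)..(x + α), kerSq n u :=
      intervalIntegral.integral_mono_interval (by linarith) (by positivity) (by linarith)
        (ae_of_all _ fun u => kerSq_nonneg n u) ((continuous_kerSq n).intervalIntegrable _ _)
    refine le_trans (le_of_eq ?_) (h1.trans h2)
    rw [intervalIntegral.integral_const, smul_eq_mul]
    field_simp
    ring
  have hT : ∫ u in (x - α)..(x + α), kerDerivSq n u ≤ 2 * Real.pi * n ^ 3 := by
    have h2 : ∫ u in (x - α)..(x + α), kerDerivSq n u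
        ≤ ∫ u in (x - Real.pi)..(x + Real.pi), kerDerivSq n u :=
      intervalIntegral.integral_mono_interval (by linarith) (by linarith) (by linarith)
        (ae_of_all _ fun u => kerDerivSq_nonneg n u)
        ((continuous_kerDerivSq n).intervalIntegrable _ _)
    rw [integral_period_kerDerivSq] at h2
    refine h2.trans ?_
    have : (n : ℝ) * (n + 1) * (2 * n + 1) / 6 ≤ n ^ 3 := by
      have : (n : ℝ) * (n + 1) * (2 * n + 1) ≤ n * (n + n) * (2 * n + n) := by gcongr
      nlinarith
    gcongr
  refine zeroDensity_div_le hn (by positivity) (lt_of_lt_of_le (by positivity) hS) (hT.trans ?_)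
  calc 2 * Real.pi * (n : ℝ) ^ 3 = 8 * Real.pi * n ^ 2 * (n / 4) := by ring
    _ ≤ _ := by gcongr

lemma integral_one_div_sin_sq_le {α x : ℝ} (hα0 : 0 < α) (hx : α < x) (hxpi : x ≤ Real.pi) :
    ∫ u in (x - α)..(x + α), 1 / Real.sin (u / 2) ^ 2 ≤ 2 * Real.pi ^ 2 / (x - α) := by
  have hpi := Real.pi_pos
  have hd0 : 0 < x - α := sub_pos.2 hx
  have hle : x - α ≤ x + α := by linarith
  have hlt : ∀ u ∈ Set.Icc (x - α) (x + α), 0 < u ∧ 0 < 2 * Real.pi - u := fun u hu =>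
    ⟨hd0.trans_le hu.1, by linarith [hu.2]⟩
  -- an antiderivative of the upper bound `π² / u² + π² / (2π - u)²`
  have hderiv : ∀ u ∈ Set.uIcc (x - α) (x + α), HasDerivAt
      (fun u => Real.pi ^ 2 * ((2 * Real.pi - u)⁻¹ - u⁻¹))
      (Real.pi ^ 2 * (1 / (2 * Real.pi - u) ^ 2 + 1 / u ^ 2)) u := by
    intro u hu
    rw [Set.uIcc_of_le hle] at hu
    obtain ⟨h1, h2⟩ := hlt u hu
    have := ((((hasDerivAt_id u).const_sub (2 * Real.pi)).fun_inv h2.ne').sub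
      ((hasDerivAt_id u).fun_inv h1.ne')).const_mul (Real.pi ^ 2)
    refine this.congr_deriv ?_
    simp only [id]
    field_simp
    ring
  have hcont : ContinuousOn (fun u => Real.pi ^ 2 * (1 / (2 * Real.pi - u) ^ 2 + 1 / u ^ 2))
      (Set.Icc (x - α) (x + α)) := by
    refine continuousOn_const.mul ((continuousOn_const.div (by fun_prop) fun u hu => ?_).add
      (continuousOn_const.div (by fun_prop) fun u hu => ?_))
    · exact pow_ne_zero 2 (hlt u hu).2.ne'
    · exact pow_ne_zero 2 (hlt u hu).1.ne'
  have hint := hcont.intervalIntegrable_of_Icc (μ := volume) hle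
  have hFTC := intervalIntegral.integral_eq_sub_of_hasDerivAt hderiv hint
  have hsin : ∀ u ∈ Set.Icc (x - α) (x + α), 0 < Real.sin (u / 2) := fun u hu =>
    (by positivity : 0 < (x - α) / Real.pi).trans_le
      (div_pi_le_sin_half hd0.le hu.1 (by linarith [hu.2]))
  have hcont2 : ContinuousOn (fun u : ℝ => 1 / Real.sin (u / 2) ^ 2)
      (Set.Icc (x - α) (x + α)) :=
    continuousOn_const.div (by fun_prop) fun u hu => pow_ne_zero 2 (hsin u hu).ne'
  have hmono := intervalIntegral.integral_mono_on hle
    (hcont2.intervalIntegrable_of_Icc (μ := volume) hle) hint fun u hu => by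
      obtain ⟨h1, h2⟩ := hlt u hu
      have hb : ∀ e : ℝ, 0 < e → e ≤ u → u ≤ 2 * Real.pi - e →
          1 / Real.sin (u / 2) ^ 2 ≤ Real.pi ^ 2 * (1 / e ^ 2) := fun e he hu1 hu2 => by
        rw [mul_one_div, ← div_pow]
        exact one_div_sin_sq_le he ((div_pi_le_sin_half he.le hu1 hu2).trans (le_abs_self _))
      have p1 : 0 ≤ Real.pi ^ 2 * (1 / (2 * Real.pi - u) ^ 2) := by positivity
      have p2 : 0 ≤ Real.pi ^ 2 * (1 / u ^ 2) := by positivity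
      rw [mul_add]
      rcases le_total u Real.pi with h | h
      · linarith [hb u h1 le_rfl (by linarith)]
      · linarith [hb (2 * Real.pi - u) h2 (by linarith) (by linarith)]
  rw [hFTC] at hmono
  refine hmono.trans ?_
  have hq1 : (2 * Real.pi - (x + α))⁻¹ ≤ (x - α)⁻¹ := inv_anti₀ hd0 (by linarith)
  have hq2 : 0 ≤ (x + α)⁻¹ := by have : 0 < x + α := by linarith
                                 positivity
  have hq3 : 0 ≤ (2 * Real.pi - (x - α))⁻¹ := by
    have : 0 < 2 * Real.pi - (x - α) := by linarith
    positivity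
  rw [← mul_sub]
  calc _ ≤ Real.pi ^ 2 * ((x - α)⁻¹ + (x - α)⁻¹) := by gcongr; linarith
    _ = _ := by ring

lemma zeroDensity_div_le_outside {α x : ℝ} (hα0 : 0 < α) (hx : α < x) (hxpi : x ≤ Real.pi)
    {n : ℕ} (hn : n ≠ 0) (hnα : 1 / (n : ℝ) ≤ α / 2) :
    zeroDensity α n x / n ≤ Real.sqrt (8 * Real.pi ^ 2 / α / (x - α)) / Real.pi := by
  have hpi := Real.pi_pos
  have hn' : (0 : ℝ) < n := by positivity
  have hd0 : 0 < x - α := sub_pos.2 hx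
  have hle : x - α ≤ x + α := by linarith
  have hS : α / 2 ≤ ∫ u in (x - α)..(x + α), kerSq n u := by
    refine le_trans ?_ (sub_one_div_le_integral_kerSq hα0 hn x)
    have : |Real.sin (n * α)| / n ≤ 1 / n := by gcongr; exact Real.abs_sin_le_one _
    linarith
  have hsin : ∀ u ∈ Set.Icc (x - α) (x + α), 0 < Real.sin (u / 2) := fun u hu =>
    (by positivity : 0 < (x - α) / Real.pi).trans_le
      (div_pi_le_sin_half hd0.le hu.1 (by linarith [hu.2]))
  have hcont2 : ContinuousOn (fun u : ℝ => 1 / Real.sin (u / 2) ^ 2)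
      (Set.Icc (x - α) (x + α)) :=
    continuousOn_const.div (by fun_prop) fun u hu => pow_ne_zero 2 (hsin u hu).ne'
  have hmono := intervalIntegral.integral_mono_on hle
    ((continuous_kerDerivSq n).intervalIntegrable _ _)
    ((hcont2.intervalIntegrable_of_Icc (μ := volume) hle).const_mul (2 * (n : ℝ) ^ 2))
    fun u hu => kerDerivSq_le n (hsin u hu).ne'
  rw [intervalIntegral.integral_const_mul] at hmono
  have hT := hmono.trans (mul_le_mul_of_nonneg_left (integral_one_div_sin_sq_le hα0 hx hxpi)
    (by positivity))
  refine zeroDensity_div_le hn (by positivity) (lt_of_lt_of_le (by positivity) hS) (hT.trans ?_)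
  calc 2 * (n : ℝ) ^ 2 * (2 * Real.pi ^ 2 / (x - α))
      = 8 * Real.pi ^ 2 / α / (x - α) * n ^ 2 * (α / 2) := by field_simp; ring
    _ ≤ _ := by gcongr

/-! ### The spectral measure of the crenel correlation -/

lemma crenelMeasure_eq (α : ℝ) :
    crenelMeasure α
      = ENNReal.ofReal (1 / (2 * α)) • volume.restrict (Set.Icc (-α) α) := by
  have : (fun x => ENNReal.ofReal (crenelDensity α x))
      = (Set.Icc (-α) α).indicator fun _ => ENNReal.ofReal (1 / (2 * α)) := by
    funext x
    by_cases hx : x ∈ Set.Icc (-α) α <;> simp [crenelDensity, hx]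
  rw [crenelMeasure, this, withDensity_indicator measurableSet_Icc, withDensity_const]

lemma isProbabilityMeasure_crenelMeasure {α : ℝ} (hα : 0 < α) :
    IsProbabilityMeasure (crenelMeasure α) := by
  constructor
  rw [crenelMeasure_eq, Measure.smul_apply, Measure.restrict_apply_univ, Real.volume_Icc,
    smul_eq_mul, ← ENNReal.ofReal_mul (by positivity)]
  rw [show 1 / (2 * α) * (α - -α) = 1 by field_simp; ring, ENNReal.ofReal_one]

lemma integral_crenelMeasure {E : Type*} [NormedAddCommGroup E] [NormedSpace ℝ E] {α : ℝ}
    (hα : 0 < α) (g : ℝ → E) :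
    ∫ x, g x ∂crenelMeasure α = (1 / (2 * α)) • ∫ x in (-α)..α, g x := by
  rw [crenelMeasure_eq, integral_smul_measure, ENNReal.toReal_ofReal (by positivity),
    intervalIntegral.integral_of_le (by linarith), integral_Icc_eq_integral_Ioc]

lemma integral_cos_crenelMeasure {α : ℝ} (hα : 0 < α) (j : ℤ) :
    ∫ x, Real.cos (j * x) ∂crenelMeasure α = crenelCorrelation α j.natAbs := by
  have h := integral_cos_int_mul hα.ne' j 0
  rw [zero_sub, zero_add, mul_zero, Real.cos_zero, mul_one] at h
  rw [integral_crenelMeasure hα, h, smul_eq_mul]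
  field_simp

lemma integral_sin_crenelMeasure {α : ℝ} (hα : 0 < α) (j : ℤ) :
    ∫ x, Real.sin (j * x) ∂crenelMeasure α = 0 := by
  have h := integral_sin_int_mul hα.ne' j 0
  rw [zero_sub, zero_add, mul_zero, Real.sin_zero, mul_zero, mul_zero] at h
  rw [integral_crenelMeasure hα, h, smul_zero]

lemma isSpectralMeasure_crenelMeasure {α : ℝ} (hα : 0 < α) (hαpi : α ≤ Real.pi) :
    IsSpectralMeasure (crenelMeasure α) (crenelCorrelation α) where
  isProbabilityMeasure := isProbabilityMeasure_crenelMeasure hα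
  support := by
    have hsub : Set.Icc (-α) α ⊆ Set.Icc (-Real.pi) Real.pi :=
      Set.Icc_subset_Icc (by linarith) hαpi
    rw [crenelMeasure_eq, Measure.smul_apply,
      Measure.restrict_apply measurableSet_Icc.compl,
      (Set.disjoint_compl_left_iff_subset.2 hsub).inter_eq, measure_empty, smul_zero]
  symmetric := by
    rw [crenelMeasure_eq, Measure.map_smul]
    congr 1
    have h := ((Measure.measurePreserving_neg (volume : Measure ℝ)).restrict_preimage
      (measurableSet_Icc (a := -α) (b := α))).map_eq
    rwa [Set.neg_preimage, Set.neg_Icc, neg_neg] at h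
  fourier k := by
    have := isProbabilityMeasure_crenelMeasure hα
    have hc : Integrable (fun x : ℝ => Real.cos (((k : ℤ) : ℝ) * x)) (crenelMeasure α) :=
      Integrable.of_bound (by fun_prop) 1 (ae_of_all _ fun x => Real.abs_cos_le_one _)
    have hs : Integrable (fun x : ℝ => Real.sin (((k : ℤ) : ℝ) * x)) (crenelMeasure α) :=
      Integrable.of_bound (by fun_prop) 1 (ae_of_all _ fun x => Real.abs_sin_le_one _)
    have e : ∀ x : ℝ, Complex.exp (Complex.I * k * x)
        = (Real.cos (((k : ℤ) : ℝ) * x) : ℂ)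
          + (Real.sin (((k : ℤ) : ℝ) * x) : ℂ) * Complex.I := by
      intro x
      rw [Complex.ofReal_cos, Complex.ofReal_sin, ← Complex.exp_mul_I]
      push_cast
      ring_nf
    simp_rw [e]
    rw [integral_add hc.ofReal (hs.ofReal.mul_const _), integral_mul_const, integral_complex_ofReal,
      integral_complex_ofReal, integral_cos_crenelMeasure hα, integral_sin_crenelMeasure hα]
    simp

/-! ### Existence of the Gaussian coefficients -/

/-- A Gram matrix of a sequence in a real inner product space has a lower triangular square root,
which exists without any linear independence: a vector depending on the earlier ones contributes a
zero column. -/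
lemma exists_triangular_of_inner {E : Type*} [NormedAddCommGroup E] [InnerProductSpace ℝ E]
    (f : ℕ → E) :
    ∃ L : ℕ → ℕ → ℝ, (∀ k j, k < j → L k j = 0) ∧
      ∀ k l N, k < N → l < N → ∑ j ∈ Finset.range N, L k j * L l j = inner ℝ (f k) (f l) := by
  set g : ℕ → E := InnerProductSpace.gramSchmidt ℝ f
  -- the coordinates of `f k` along the orthogonal vectors `g j`
  let d : ℕ → ℕ → ℝ := fun k j =>
    if j < k then inner ℝ (g j) (f k) / ‖g j‖ ^ 2 else if j = k then 1 else 0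
  have hd : ∀ k j, k < j → d k j = 0 := fun k j h => by
    simp [d, h.not_gt, h.ne']
  have hf : ∀ k N, k < N → f k = ∑ j ∈ Finset.range N, d k j • g j := by
    intro k N hk
    have hsub : Finset.range (k + 1) ⊆ Finset.range N := by
      intro j hj
      simp only [Finset.mem_range] at hj ⊢
      omega
    rw [← Finset.sum_subset hsub, Finset.sum_range_succ]
    · have h := InnerProductSpace.gramSchmidt_def'' ℝ f k
      have e : Finset.Iio k = Finset.range k := by ext; simp
      rw [e] at h
      rw [add_comm]
      conv_lhs => rw [h]
      congr 1
      · simp [d, g]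
      · refine Finset.sum_congr rfl fun j hj => ?_
        simp [d, g, Finset.mem_range.1 hj]
    · intro j _ hj
      rw [hd k j (by simpa using hj), zero_smul]
  refine ⟨fun k j => d k j * ‖g j‖, fun k j h => by simp [hd k j h], fun k l N hk hl => ?_⟩
  rw [hf k N hk, hf l N hl, sum_inner]
  refine Finset.sum_congr rfl fun j hj => ?_
  rw [inner_sum, Finset.sum_eq_single_of_mem j hj]
  · rw [real_inner_smul_left, real_inner_smul_right, real_inner_self_eq_norm_sq]
    ring
  · intro i _ hij
    rw [real_inner_smul_left, real_inner_smul_right,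
      InnerProductSpace.gramSchmidt_orthogonal ℝ f hij.symm]
    simp

/-- The crenel correlation is the Gram matrix of the exponentials `x ↦ exp (i k x)` in the real
Hilbert space of complex valued square integrable functions for the spectral measure. -/
lemma exists_inner_eq_crenelCorrelation {α : ℝ} (hα : 0 < α) :
    ∃ f : ℕ → Lp ℂ 2 (crenelMeasure α), ∀ k l : ℕ,
      inner ℝ (f k) (f l) = crenelCorrelation α ((k : ℤ) - (l : ℤ)).natAbs := by
  have := isProbabilityMeasure_crenelMeasure hα
  have hmem : ∀ k : ℕ, MemLp (fun x : ℝ => Complex.exp ((k * x : ℝ) * Complex.I)) 2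
      (crenelMeasure α) := fun k =>
    MemLp.of_bound (by fun_prop) 1
      (ae_of_all _ fun x => by rw [Complex.norm_exp_ofReal_mul_I])
  refine ⟨fun k => (hmem k).toLp _, fun k l => ?_⟩
  rw [L2.inner_def, ← integral_cos_crenelMeasure hα]
  refine integral_congr_ae ?_
  filter_upwards [(hmem k).coeFn_toLp, (hmem l).coeFn_toLp] with x hk hl
  rw [hk, hl, Complex.inner, ← Complex.exp_conj, ← Complex.exp_add]
  rw [← Real.cos_neg]
  have : (starRingEnd ℂ) ((k * x : ℝ) * Complex.I) + (l * x : ℝ) * Complex.I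
      = ((-((((k : ℤ) - (l : ℤ) : ℤ) : ℝ) * x) : ℝ) : ℂ) * Complex.I := by
    rw [map_mul, Complex.conj_ofReal, Complex.conj_I]
    push_cast
    ring
  rw [add_comm, this, Complex.exp_ofReal_mul_I_re]

/-- Finite linear combinations of independent standard Gaussian variables, with coefficients given
by a triangular square root of the correlation, realise the two coefficient sequences. -/
lemma exists_isModel {α : ℝ} (hα : 0 < α) :
    ∃ (Ω : Type) (_ : MeasurableSpace Ω) (P : Measure Ω) (_ : IsProbabilityMeasure P)
      (a b : ℕ → Ω → ℝ), IsModel P (crenelCorrelation α) a b := by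
  obtain ⟨f, hf⟩ := exists_inner_eq_crenelCorrelation hα
  obtain ⟨L, hL0, hL⟩ := exists_triangular_of_inner f
  obtain ⟨Ω, mΩ, P, X, hXm, hXlaw, hXind, hP⟩ :=
    exists_iid (ℕ ⊕ ℕ) (gaussianReal 0 1)
  have hXg : ∀ i, HasGaussianLaw (X i) P := fun i => (hXlaw i).hasGaussianLaw
  have hX2 : ∀ i, MemLp (X i) 2 P := fun i => (hXg i).memLp_two
  have hX0 : ∀ i, ∫ ω, X i ω ∂P = 0 := fun i => by
    have := (hXlaw i).integral_eq
    simpa using this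
  have hXcov : ∀ i j, ∫ ω, X i ω * X j ω ∂P = if i = j then 1 else 0 := by
    intro i j
    split_ifs with hij
    · subst hij
      have := (hXlaw i).variance_eq
      rw [variance_of_integral_eq_zero (hXm i).aemeasurable (hX0 i)] at this
      simpa [pow_two] using this
    · have := (hXind.indepFun hij).integral_mul_eq_mul_integral
        (hXm i).aestronglyMeasurable (hXm j).aestronglyMeasurable
      simpa [hX0] using this
  have hXproc : IsGaussianProcess X P :=
    ⟨fun I => iIndepFun.hasGaussianLaw (fun i => hXg i)
      (hXind.precomp Subtype.val_injective)⟩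
  let c : (ℕ → ℕ ⊕ ℕ) → ℕ → Ω → ℝ := fun ι k ω => ∑ j ∈ Finset.range (k + 1), L k j * X (ι j) ω
  have hcm : ∀ ι k, Measurable (c ι k) := fun ι k =>
    Finset.measurable_sum _ fun j _ => (hXm _).const_mul _
  have hc0 : ∀ ι k, ∫ ω, c ι k ω ∂P = 0 := fun ι k => by
    simp only [c]
    rw [integral_finsetSum _ fun j _ => ((hX2 _).integrable one_le_two).const_mul _]
    simp [integral_const_mul, hX0]
  have hint : ∀ i j, Integrable (fun ω => X i ω * X j ω) P := fun i j =>
    (hX2 i).integrable_mul (hX2 j)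
  have hprod : ∀ ι κ k l, ∫ ω, c ι k ω * c κ l ω ∂P
      = ∑ i ∈ Finset.range (k + 1), ∑ j ∈ Finset.range (l + 1),
        L k i * L l j * (if ι i = κ j then 1 else 0) := by
    intro ι κ k l
    have e : ∀ ω, c ι k ω * c κ l ω = ∑ i ∈ Finset.range (k + 1), ∑ j ∈ Finset.range (l + 1),
        L k i * L l j * (X (ι i) ω * X (κ j) ω) := fun ω => by
      simp only [c]
      rw [Finset.sum_mul_sum]
      refine Finset.sum_congr rfl fun i _ => Finset.sum_congr rfl fun j _ => by ring
    simp_rw [e]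
    rw [integral_finsetSum _ fun i _ => integrable_finsetSum _ fun j _ =>
      (hint _ _).const_mul _]
    refine Finset.sum_congr rfl fun i _ => ?_
    rw [integral_finsetSum _ fun j _ => (hint _ _).const_mul _]
    refine Finset.sum_congr rfl fun j _ => ?_
    rw [integral_const_mul, hXcov]
  have hcorr : ∀ ι : ℕ → ℕ ⊕ ℕ, Function.Injective ι → ∀ k l,
      ∫ ω, c ι k ω * c ι l ω ∂P = crenelCorrelation α ((k : ℤ) - (l : ℤ)).natAbs := by
    intro ι hι k l
    rw [hprod, ← hf, ← hL k l (k + 1 + (l + 1)) (by omega) (by omega)]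
    have hsub : Finset.range (k + 1) ⊆ Finset.range (k + 1 + (l + 1)) :=
      Finset.range_subset_range.2 (by omega)
    rw [← Finset.sum_subset hsub fun i _ hi => by
      rw [hL0 k i (by simpa using hi), zero_mul]]
    refine Finset.sum_congr rfl fun i _ => ?_
    simp only [hι.eq_iff, mul_ite, mul_one, mul_zero, Finset.sum_ite_eq, Finset.mem_range]
    split_ifs with h
    · rfl
    · rw [hL0 l i (by omega), mul_zero]
  have hproc : IsGaussianProcess (Sum.elim (c Sum.inl) (c Sum.inr)) P := by
    have key : ∀ ι k, ∃ I : Finset (ℕ ⊕ ℕ), ∃ T : (I → ℝ) →L[ℝ] ℝ,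
        ∀ ω, c ι k ω = T (I.restrict (X · ω)) := by
      intro ι k
      let I := (Finset.range (k + 1)).image ι
      have hI : ∀ j : Finset.range (k + 1), ι j ∈ I := fun j =>
        Finset.mem_image_of_mem _ j.2
      refine ⟨I, ∑ j : Finset.range (k + 1), L k j • ContinuousLinearMap.proj ⟨ι j, hI j⟩,
        fun ω => ?_⟩
      simp only [c]
      rw [← Finset.sum_coe_sort]
      simp
    exact hXproc.of_isGaussianProcess fun s => by
      rcases s with k | k
      · exact key Sum.inl k
      · exact key Sum.inr k
  have hstat : ∀ ι : ℕ → ℕ ⊕ ℕ, Function.Injective ι → IsGaussianProcess (c ι) P →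
      IsStationaryGaussian P (crenelCorrelation α) (c ι) := fun ι hι hg =>
    ⟨hcm ι, hg, hc0 ι, hcorr ι hι⟩
  refine ⟨Ω, mΩ, P, hP, c Sum.inl, c Sum.inr,
    hstat _ Sum.inl_injective (hproc.comp_right Sum.inl),
    hstat _ Sum.inr_injective (hproc.comp_right Sum.inr), ?_⟩
  refine hproc.indepFun_of_covariance_eq_zero (fun k => (hcm _ k).aemeasurable)
    (fun k => (hcm _ k).aemeasurable) fun k l => ?_
  have hmem : ∀ ι k, MemLp (c ι k) 2 P := fun ι k =>
    memLp_finsetSum _ fun j _ => (hX2 _).const_mul _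
  rw [covariance_eq_sub (hmem _ _) (hmem _ _)]
  simp only [Pi.mul_apply, hprod, hc0]
  simp

/-! ### The limit of the mean number of zeros -/

lemma integrableOn_inv_sqrt_sub (α s t : ℝ) :
    IntegrableOn (fun x : ℝ => |(x - α) ^ (-(1 / 2) : ℝ)|) (Set.Icc s t) := by
  rcases le_or_gt s t with hst | hst
  · have h := (intervalIntegral.intervalIntegrable_rpow' (a := s - α) (b := t - α)
      (r := -(1 / 2)) (by norm_num)).comp_sub_right α
    simp only [sub_add_cancel] at h
    rw [integrableOn_Icc_iff_integrableOn_Ioc, ← intervalIntegrable_iff_integrableOn_Ioc_of_le hst]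
    exact h.abs
  · rw [Set.Icc_eq_empty hst.not_ge]
    exact integrableOn_empty

lemma sqrt_bound_eq {α x : ℝ} (hα : 0 < α) (hx : α < x) :
    Real.sqrt (8 * Real.pi ^ 2 / α / (x - α)) / Real.pi
      = Real.sqrt (8 / α) * |(x - α) ^ (-(1 / 2) : ℝ)| := by
  have hx' : 0 < x - α := sub_pos.2 hx
  rw [abs_of_pos (Real.rpow_pos_of_pos hx' _), Real.rpow_neg hx'.le, ← Real.sqrt_eq_rpow,
    show 8 * Real.pi ^ 2 / α / (x - α) = Real.pi ^ 2 * (8 / α / (x - α)) by ring,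
    Real.sqrt_mul (by positivity), Real.sqrt_sq Real.pi_pos.le,
    mul_div_cancel_left₀ _ Real.pi_ne_zero, Real.sqrt_div (by positivity), div_eq_mul_inv]

/-- Dominated convergence on the half period: near the edge `α` of the support the densities are
controlled by an integrable multiple of `(x - α) ^ (-1/2)`. -/
lemma tendsto_lintegral_zeroDensity {α : ℝ} (hα : 0 < α) (hαpi : α ≤ Real.pi) :
    Tendsto (fun n : ℕ => ∫⁻ x in Set.Icc 0 Real.pi, ENNReal.ofReal (zeroDensity α n x / n)) atTop
      (𝓝 (ENNReal.ofReal (α / (Real.pi * Real.sqrt 3)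
        + (Real.pi - α) / (Real.pi * Real.sqrt 2)))) := by
  have hval : ∫⁻ x in Set.Icc 0 Real.pi, ENNReal.ofReal
      (if x < α then 1 / (Real.pi * Real.sqrt 3) else 1 / (Real.pi * Real.sqrt 2))
      = ENNReal.ofReal (α / (Real.pi * Real.sqrt 3)
        + (Real.pi - α) / (Real.pi * Real.sqrt 2)) := by
    rw [← Set.Ico_union_Icc_eq_Icc hα.le hαpi, lintegral_union measurableSet_Icc
      (Set.disjoint_left.2 fun x hx hx' => hx.2.not_ge hx'.1),
      setLIntegral_congr_fun (g := fun _ => ENNReal.ofReal (1 / (Real.pi * Real.sqrt 3)))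
        measurableSet_Ico fun x hx => by simp only [if_pos hx.2],
      setLIntegral_congr_fun (g := fun _ => ENNReal.ofReal (1 / (Real.pi * Real.sqrt 2)))
        measurableSet_Icc fun x hx => by simp only [if_neg hx.1.not_gt],
      setLIntegral_const, setLIntegral_const, Real.volume_Ico, Real.volume_Icc, sub_zero,
      ← ENNReal.ofReal_mul (by positivity), ← ENNReal.ofReal_mul (by positivity),
      ← ENNReal.ofReal_add (by positivity) (mul_nonneg (by positivity) (by linarith))]
    congr 1
    ring
  have hae : ∀ᵐ x ∂volume.restrict (Set.Icc 0 Real.pi), x ∈ Set.Icc 0 Real.pi ∧ x ≠ α :=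
    (ae_restrict_mem measurableSet_Icc).and (ae_restrict_of_ae (Measure.ae_ne volume α))
  have hbd : Integrable (fun x : ℝ => Real.sqrt (8 * Real.pi) / Real.pi
      + Real.sqrt (8 / α) * |(x - α) ^ (-(1 / 2) : ℝ)|) (volume.restrict (Set.Icc 0 Real.pi)) :=
    (integrable_const _).add ((integrableOn_inv_sqrt_sub α 0 Real.pi).const_mul _)
  have hsmall : ∀ᶠ n : ℕ in atTop, 1 / (n : ℝ) ≤ α / 2 :=
    (tendsto_const_div_nat 1).eventually_le_const (half_pos hα)
  rw [← hval]
  refine tendsto_lintegral_filter_of_dominated_convergence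
    (fun x => ENNReal.ofReal (Real.sqrt (8 * Real.pi) / Real.pi
      + Real.sqrt (8 / α) * |(x - α) ^ (-(1 / 2) : ℝ)|)) ?_ ?_ ?_ ?_
  · exact Eventually.of_forall fun n => ((measurable_zeroDensity α n).div_const _).ennreal_ofReal
  · filter_upwards [hsmall, eventually_ne_atTop 0] with n hn hn0
    filter_upwards [hae] with x hx
    refine ENNReal.ofReal_le_ofReal ?_
    have h0 : 0 ≤ Real.sqrt (8 * Real.pi) / Real.pi := by positivity
    have h1 : 0 ≤ Real.sqrt (8 / α) * |(x - α) ^ (-(1 / 2) : ℝ)| := by positivity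
    rcases lt_or_gt_of_ne hx.2 with h | h
    · have := zeroDensity_div_le_inside hαpi hx.1.1 h hn0 (by linarith)
      linarith
    · have := zeroDensity_div_le_outside hα h hx.1.2 hn0 hn
      rw [sqrt_bound_eq hα h] at this
      linarith
  · exact hbd.lintegral_lt_top.ne
  · filter_upwards [hae] with x hx
    refine (ENNReal.continuous_ofReal.tendsto _).comp ?_
    rcases lt_or_gt_of_ne hx.2 with h | h
    · rw [if_pos h]
      exact tendsto_zeroDensity_inside hαpi hx.1.1 h
    · rw [if_neg h.not_gt]
      exact tendsto_zeroDensity_outside hα h hx.1.2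

/-- By the symmetry `x ↦ 2π - x`, both halves of the period contribute equally. -/
lemma lintegral_zeroDensity_period (α : ℝ) (n : ℕ) :
    ∫⁻ x in Set.Icc 0 (2 * Real.pi), ENNReal.ofReal (zeroDensity α n x)
      = 2 * ∫⁻ x in Set.Icc 0 Real.pi, ENNReal.ofReal (zeroDensity α n x) := by
  have hpi := Real.pi_pos
  have hrefl : ∫⁻ x in Set.Icc Real.pi (2 * Real.pi), ENNReal.ofReal (zeroDensity α n x)
      = ∫⁻ x in Set.Icc 0 Real.pi, ENNReal.ofReal (zeroDensity α n x) := by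
    have h := (Measure.measurePreserving_sub_left (volume : Measure ℝ)
      (2 * Real.pi)).setLIntegral_comp_preimage (s := Set.Icc 0 Real.pi) measurableSet_Icc
      (measurable_zeroDensity α n).ennreal_ofReal
    simp only [zeroDensity_two_pi_sub, Set.preimage_const_sub_Icc, sub_zero] at h
    rwa [show 2 * Real.pi - Real.pi = Real.pi by ring] at h
  rw [← Set.Ico_union_Icc_eq_Icc hpi.le (by linarith : Real.pi ≤ 2 * Real.pi),
    lintegral_union measurableSet_Icc
      (Set.disjoint_left.2 fun x hx hx' => hx.2.not_ge hx'.1),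
    hrefl, setLIntegral_congr Ico_ae_eq_Icc, two_mul]

theorem meanZerosTendsto {Ω : Type*} [MeasurableSpace Ω] {P : Measure Ω} [IsProbabilityMeasure P]
    {a b : ℕ → Ω → ℝ} {α : ℝ} (hα : 0 < α) (hαpi : α ≤ Real.pi)
    (h : IsModel P (crenelCorrelation α) a b) :
    MeanZerosTendsto P a b ((2 * Real.pi - 2 * α) / (Real.pi * Real.sqrt 2)
      + 2 * α / (Real.pi * Real.sqrt 3)) := by
  refine ⟨fun n => (measurable_zeroCount_trigPoly h.left.measurable
    h.right.measurable n _ _).aemeasurable, ?_⟩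
  have hlim := ENNReal.Tendsto.const_mul (a := 2) (tendsto_lintegral_zeroDensity hα hαpi)
    (Or.inr ENNReal.ofNat_ne_top)
  rw [← ENNReal.ofReal_ofNat, ← ENNReal.ofReal_mul zero_le_two,
    show (2 : ℝ) * (α / (Real.pi * Real.sqrt 3) + (Real.pi - α) / (Real.pi * Real.sqrt 2))
      = (2 * Real.pi - 2 * α) / (Real.pi * Real.sqrt 2)
        + 2 * α / (Real.pi * Real.sqrt 3) by ring] at hlim
  refine hlim.congr' ?_
  filter_upwards [eventually_ne_atTop 0] with n hn
  have hn0 : (0 : ℝ) < n := by exact_mod_cast Nat.pos_of_ne_zero hn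
  rw [h.lintegral_zeroCount hα hn, lintegral_zeroDensity_period, ENNReal.ofReal_ofNat,
    div_eq_mul_inv _ (n : ℝ≥0∞), mul_assoc, ← lintegral_mul_const _
      (measurable_zeroDensity α n).ennreal_ofReal]
  congr 1
  refine lintegral_congr fun x => ?_
  rw [ENNReal.ofReal_div_of_pos hn0, ENNReal.ofReal_natCast, div_eq_mul_inv]

/-- The limit is affine in `α`, with value `√2` at `α = 0` and `2 / √3` at `α = π`. -/
lemma exists_limit_eq {l : ℝ} (h1 : 2 / Real.sqrt 3 ≤ l) (h2 : l < Real.sqrt 2) :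
    ∃ α : ℝ, 0 < α ∧ α ≤ Real.pi ∧
      (2 * Real.pi - 2 * α) / (Real.pi * Real.sqrt 2) + 2 * α / (Real.pi * Real.sqrt 3) = l := by
  have hpi := Real.pi_pos
  have h3 : 0 < Real.sqrt 2 - 2 / Real.sqrt 3 := by linarith
  refine ⟨Real.pi * ((Real.sqrt 2 - l) / (Real.sqrt 2 - 2 / Real.sqrt 3)),
    mul_pos hpi (div_pos (by linarith) h3),
    mul_le_of_le_one_right hpi.le ((div_le_one h3).2 (by linarith)), ?_⟩
  set s := (Real.sqrt 2 - l) / (Real.sqrt 2 - 2 / Real.sqrt 3) with hs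
  have hs' : s * (Real.sqrt 2 - 2 / Real.sqrt 3) = Real.sqrt 2 - l := div_mul_cancel₀ _ h3.ne'
  have e2 : 2 / Real.sqrt 2 = Real.sqrt 2 := Real.div_sqrt
  calc (2 * Real.pi - 2 * (Real.pi * s)) / (Real.pi * Real.sqrt 2)
        + 2 * (Real.pi * s) / (Real.pi * Real.sqrt 3)
      = (1 - s) * (2 / Real.sqrt 2) + s * (2 / Real.sqrt 3) := by
        field_simp
    _ = l := by rw [e2]; linear_combination -hs'

end TrigZeros

theorem corollary1 :
    (∀ α : ℝ, 0 < α → α < Real.pi →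
      TrigZeros.IsSpectralMeasure (TrigZeros.crenelMeasure α) (TrigZeros.crenelCorrelation α) ∧
      ∀ (Ω : Type*) [MeasurableSpace Ω] (P : Measure Ω) [IsProbabilityMeasure P]
        (a b : ℕ → Ω → ℝ), TrigZeros.IsModel P (TrigZeros.crenelCorrelation α) a b →
          TrigZeros.MeanZerosTendsto P a b
            ((2 * Real.pi - 2 * α) / (Real.pi * Real.sqrt 2)
              + 2 * α / (Real.pi * Real.sqrt 3))) ∧
    (∀ l : ℝ, 2 / Real.sqrt 3 ≤ l → l < Real.sqrt 2 →
      ∃ α : ℝ, 0 < α ∧ α ≤ Real.pi ∧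
        TrigZeros.IsSpectralMeasure (TrigZeros.crenelMeasure α) (TrigZeros.crenelCorrelation α) ∧
        (∃ (Ω : Type) (_ : MeasurableSpace Ω) (P : Measure Ω) (_ : IsProbabilityMeasure P)
          (a b : ℕ → Ω → ℝ), TrigZeros.IsModel P (TrigZeros.crenelCorrelation α) a b) ∧
        (∀ (Ω : Type*) [MeasurableSpace Ω] (P : Measure Ω) [IsProbabilityMeasure P]
          (a b : ℕ → Ω → ℝ), TrigZeros.IsModel P (TrigZeros.crenelCorrelation α) a b →
            TrigZeros.MeanZerosTendsto P a b l)) := by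
  refine ⟨fun α hα hαpi => ⟨TrigZeros.isSpectralMeasure_crenelMeasure hα hαpi.le,
    fun Ω _ P _ a b h => TrigZeros.meanZerosTendsto hα hαpi.le h⟩, fun l h1 h2 => ?_⟩
  obtain ⟨α, hα, hαpi, rfl⟩ := TrigZeros.exists_limit_eq h1 h2
  exact ⟨α, hα, hαpi, TrigZeros.isSpectralMeasure_crenelMeasure hα hαpi,
    TrigZeros.exists_isModel hα, fun Ω _ P _ a b h => TrigZeros.meanZerosTendsto hα hαpi h⟩
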